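/- **Proposition.** Let $N\in\mathbb{N}$ and let $\mathrm{d}U$ be the normalized Haar measure on $\mathrm{SU}(N)$. Representations are finite-dimensional, continuous and complex, $\chi_R(U)=\mathrm{Tr}\,R(U)$, $\overline R$ is the complex conjugate representation, and $\mathfrak{R}(\mathrm{SU}(N))$ is the Grothendieck ring: the Grothendieck completion of the semiring of isomorphism classes of representations under $\oplus$ and $\otimes$, with $[R]$ the class of $R$. For a representation $R$ let $\Omega_R=\sum_i \mathrm{d}R(X_i)\,\mathrm{d}R(X^i)$ be its quadratic Casimir operator, where $(X_i)$ is a basis of $\mathfrak{su}(N)$ and $(X^i)$ its dual basis for the form $\mathrm{Tr}(XY)$, and let $C_2(R)=\mathrm{Re}\,\mathrm{Tr}\,\Omega_R/\dim R$. Consider two-dimensional $\mathrm{SU}(N)$ Yang–Mills theory with coupling $g\in\mathbb{R}$ on a surface $\Sigma$ of genus $p\ge 0$ and area $a$ with one boundary circle (the disk of area $\tfrac12$ is the case $p=0$, $a=\tfrac12$). Let the Wilson loop $W_R$ run along $-\partial\Sigma$, and let $V[U]$ be the topological point operator that prescribes the holonomy around an interior point to lie in the conjugacy class of $U\in\mathrm{SU}(N)$.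 Their correlator is $$\langle U,R\rangle=\langle V[U]\,W_R\rangle=\int \mathrm{d}h\prod_{i=1}^p\mathrm{d}A_i\,\mathrm{d}B_i\ \mathrm{Tr}\Big(R\big(h^{-1}Uh\,\textstyle\prod_{i}A_iB_iA_i^{-1}B_i^{-1}\big)\,\mathrm{e}^{-\frac{g^2a}{2}\Omega_R}\Big),$$ with all integrals over $\mathrm{SU}(N)$. If the loop runs along $+\partial\Sigma$ instead, the argument of $R$ is replaced by its inverse. The correlator depends only on the conjugacy class of $U$ and on the isomorphism class of $R$, and extends additively to $\langle U,x\rangle$ for $x\in\mathfrak{R}(\mathrm{SU}(N))$. For either direction of the loop put $$\langle x|y\rangle=\int\mathrm{d}U\,\langle U,x\rangle\,\langle U,y\rangle,\qquad \mathcal{G}_\kappa(x)=\int\mathrm{d}U\,\chi_\kappa(U)\,\langle U,x\rangle ,$$ where $\mathcal G_\kappa$ is the gauging of the non-invertible 1-form symmetry with generalized $\theta$-angle $\kappa$, an irreducible representation. Write $w(R)=(\dim R)^{-2p}\,\mathrm{e}^{-\frac{g^2a}{2}C_2(R)}$. Let $\kappa^*=\overline\kappa$ if the loop runs along $-\partial\Sigma$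 and $\kappa^*=\kappa$ if it runs along $+\partial\Sigma$. Then: 1. For irreducible $R$, $\Omega_R=C_2(R)\,\mathbb{1}$, and $\langle U,R\rangle=\chi_R(U)\,w(R)$ for a loop along $-\partial\Sigma$, $\langle U,R\rangle=\chi_R(U^{-1})\,w(R)$ for a loop along $+\partial\Sigma$. 2. For either direction, the integrand of $\mathcal G_\kappa(x)$ is integrable for every $x$; for irreducible $R_1,R_2,R$ one has $\langle R_1|R_2\rangle=w(R_2)^2\,\delta_{\overline{R_1},R_2}$ and $\mathcal G_\kappa([R])=w(R)\,\delta_{\kappa^*,R}$, where $\delta_{R,S}$ is $1$ if $R\cong S$ and $0$ otherwise. 3. For all $x\in\mathfrak{R}(\mathrm{SU}(N))$, $\mathcal G_\kappa(x)=w(\kappa)^{-1}\langle\kappa|x\rangle$ for a loop along $-\partial\Sigma$, and $\mathcal G_\kappa(x)=w(\kappa)^{-1}\langle\overline\kappa|x\rangle$ for a loop along $+\partial\Sigma$. 4. For either direction there is exactly one additive map $P:\mathfrak{R}(\mathrm{SU}(N))\to\mathfrak{R}(\mathrm{SU}(N))$ such that $P[R]=[R]$ for irreducible $R\cong\kappa^*$,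 $P[R]=0$ for every other irreducible $R$, $P\circ P=P$, and for every $x$ there is $n\in\mathbb{Z}$ with $P(x)=n\,[\kappa^*]$ and $\mathcal G_\kappa(x)=n\,w(\kappa)$. -/

import Mathlib

open Matrix MeasureTheory

noncomputable section


namespace YM

/-! ## Finite-dimensional continuous representations and the Grothendieck ring -/

/-- A finite-dimensional continuous complex representation of a topological group `G`,
written in a basis. -/
structure MatRep (G : Type) [Group G] [TopologicalSpace G] where
  /-- the dimension -/
  dim : ℕ
  /-- the representing matrices -/
  mat : G →* Matrix (Fin dim) (Fin dim) ℂ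
  continuous_mat : Continuous mat

/-- Similarity of two families of matrices; a technical form of isomorphism that allows
arbitrary index types. -/
def Sim {G ι κ : Type} [Fintype ι] [DecidableEq ι] [Fintype κ] [DecidableEq κ]
    (ρ : G → Matrix ι ι ℂ) (σ : G → Matrix κ κ ℂ) : Prop :=
  ∃ (P : Matrix κ ι ℂ) (Q : Matrix ι κ ℂ), P * Q = 1 ∧ Q * P = 1 ∧ ∀ g, P * ρ g = σ g * P

namespace Sim

variable {G ι κ μ ι' κ' : Type} [Fintype ι] [DecidableEq ι] [Fintype κ] [DecidableEq κ]
  [Fintype μ] [DecidableEq μ] [Fintype ι'] [DecidableEq ι'] [Fintype κ'] [DecidableEq κ']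
  {ρ : G → Matrix ι ι ℂ} {σ : G → Matrix κ κ ℂ} {τ : G → Matrix μ μ ℂ}
  {ρ' : G → Matrix ι' ι' ℂ} {σ' : G → Matrix κ' κ' ℂ}

lemma eq_conj {P : Matrix κ ι ℂ} {Q : Matrix ι κ ℂ} (h1 : P * Q = 1)
    {A : Matrix ι ι ℂ} {B : Matrix κ κ ℂ} (h : P * A = B * P) : B = P * A * Q := by
  rw [h, Matrix.mul_assoc, h1, Matrix.mul_one]

lemma symm (h : Sim ρ σ) : Sim σ ρ := by
  obtain ⟨P, Q, h1, h2, h3⟩ := h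
  refine ⟨Q, P, h2, h1, fun g => ?_⟩
  rw [eq_conj h1 (h3 g), ← Matrix.mul_assoc, ← Matrix.mul_assoc, h2, Matrix.one_mul]

lemma trans (h : Sim ρ σ) (h' : Sim σ τ) : Sim ρ τ := by
  obtain ⟨P, Q, h1, h2, h3⟩ := h
  obtain ⟨P', Q', h1', h2', h3'⟩ := h'
  refine ⟨P' * P, Q * Q', ?_, ?_, fun g => ?_⟩
  · rw [Matrix.mul_assoc, ← Matrix.mul_assoc P, h1, Matrix.one_mul, h1']
  · rw [Matrix.mul_assoc, ← Matrix.mul_assoc Q', h2', Matrix.one_mul, h2]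
  · rw [Matrix.mul_assoc, h3, ← Matrix.mul_assoc, h3', Matrix.mul_assoc]

lemma of_reindex (e : ι ≃ κ) (h : ∀ g i j, σ g (e i) (e j) = ρ g i j) : Sim ρ σ := by
  refine ⟨(1 : Matrix κ κ ℂ).submatrix id e, (1 : Matrix κ κ ℂ).submatrix e id, ?_, ?_,
    fun g => ?_⟩
  · ext i j
    simp [Matrix.mul_apply, Matrix.one_apply, ← e.eq_symm_apply]
  · ext i j
    simp [Matrix.mul_apply, Matrix.one_apply]
  · ext i j
    obtain ⟨i, rfl⟩ := e.surjective i
    simp [Matrix.mul_apply, Matrix.one_apply, h]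

lemma sum (h : Sim ρ σ) (h' : Sim ρ' σ') :
    Sim (fun g => fromBlocks (ρ g) 0 0 (ρ' g)) (fun g => fromBlocks (σ g) 0 0 (σ' g)) := by
  obtain ⟨P, Q, h1, h2, h3⟩ := h
  obtain ⟨P', Q', h1', h2', h3'⟩ := h'
  refine ⟨fromBlocks P 0 0 P', fromBlocks Q 0 0 Q', ?_, ?_, fun g => ?_⟩ <;>
    simp [fromBlocks_multiply, *]

lemma kron (h : Sim ρ σ) (h' : Sim ρ' σ') :
    Sim (fun g => kroneckerMap (· * ·) (ρ g) (ρ' g))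
      (fun g => kroneckerMap (· * ·) (σ g) (σ' g)) := by
  obtain ⟨P, Q, h1, h2, h3⟩ := h
  obtain ⟨P', Q', h1', h2', h3'⟩ := h'
  refine ⟨kroneckerMap (· * ·) P P', kroneckerMap (· * ·) Q Q', ?_, ?_, fun g => ?_⟩ <;>
    simp [← mul_kronecker_mul, *]

end Sim

namespace MatRep

variable {G : Type} [Group G] [TopologicalSpace G]

/-- The underlying representation on `ℂⁿ` in the sense of Mathlib. -/
def toRep (R : MatRep G) : Representation ℂ G (Fin R.dim → ℂ) :=
  (Matrix.toLinAlgEquiv' : Matrix (Fin R.dim) (Fin R.dim) ℂ ≃ₐ[ℂ] _).toMonoidHom.comp R.mat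

/-- Isomorphism of representations. -/
def Iso (R S : MatRep G) : Prop := Nonempty (R.toRep.Equiv S.toRep)

/-- Irreducibility: nonzero, and no proper nonzero invariant subspace. -/
def IsIrreducible (R : MatRep G) : Prop := R.toRep.IsIrreducible

/-- The character `g ↦ Tr R(g)`. -/
def char (R : MatRep G) (g : G) : ℂ := (R.mat g).trace

lemma iso_iff_sim {R S : MatRep G} : R.Iso S ↔ Sim R.mat S.mat := by
  constructor
  · rintro ⟨e⟩
    refine ⟨LinearMap.toMatrix' e.toLinearEquiv.toLinearMap,
      LinearMap.toMatrix' e.toLinearEquiv.symm.toLinearMap, ?_, ?_, fun g => ?_⟩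
    · rw [← LinearMap.toMatrix'_comp, LinearEquiv.comp_symm, LinearMap.toMatrix'_id]
    · rw [← LinearMap.toMatrix'_comp, LinearEquiv.symm_comp, LinearMap.toMatrix'_id]
    · have := congrArg LinearMap.toMatrix' (e.toIntertwiningMap.isIntertwining' g)
      rw [LinearMap.toMatrix'_comp, LinearMap.toMatrix'_comp] at this
      have hR : LinearMap.toMatrix' (R.toRep g) = R.mat g := LinearMap.toMatrix'_toLin' _
      have hS : LinearMap.toMatrix' (S.toRep g) = S.mat g := LinearMap.toMatrix'_toLin' _
      rw [hR, hS] at this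
      exact this
  · rintro ⟨P, Q, h1, h2, h3⟩
    refine ⟨Representation.Equiv.mk
      (LinearEquiv.ofLinearMap (Matrix.toLin' P) (Matrix.toLin' Q) ?_ ?_) fun g => ?_⟩
    · rw [← Matrix.toLin'_mul, h1, Matrix.toLin'_one]
    · rw [← Matrix.toLin'_mul, h2, Matrix.toLin'_one]
    · change Matrix.toLin' P ∘ₗ Matrix.toLin' (R.mat g) =
        Matrix.toLin' (S.mat g) ∘ₗ Matrix.toLin' P
      rw [← Matrix.toLin'_mul, ← Matrix.toLin'_mul, h3]

instance setoid (G : Type) [Group G] [TopologicalSpace G] : Setoid (MatRep G) where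
  r := Iso
  iseqv :=
    { refl := fun _ => ⟨Representation.Equiv.refl _⟩
      symm := fun ⟨e⟩ => ⟨e.symm⟩
      trans := fun ⟨e⟩ ⟨f⟩ => ⟨e.trans f⟩ }

/-- The zero-dimensional representation. -/
def zero (G : Type) [Group G] [TopologicalSpace G] : MatRep G where
  dim := 0
  mat := 1
  continuous_mat := continuous_const

/-- The one-dimensional trivial representation. -/
def triv (G : Type) [Group G] [TopologicalSpace G] : MatRep G where
  dim := 1
  mat := 1
  continuous_mat := continuous_const

/-- The direct sum, by block diagonal matrices. -/
def sum (R S : MatRep G) : MatRep G where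
  dim := R.dim + S.dim
  mat :=
    { toFun := fun g => reindex finSumFinEquiv finSumFinEquiv
        (fromBlocks (R.mat g) 0 0 (S.mat g))
      map_one' := by simp
      map_mul' := fun g h => by
        simp [fromBlocks_multiply, submatrix_mul_equiv] }
  continuous_mat := by
    have := R.continuous_mat
    have := S.continuous_mat
    exact Continuous.matrix_submatrix (by fun_prop) _ _

/-- The tensor product, by Kronecker products. -/
def tensor (R S : MatRep G) : MatRep G where
  dim := R.dim * S.dim
  mat :=
    { toFun := fun g => reindex finProdFinEquiv finProdFinEquiv
        (kroneckerMap (· * ·) (R.mat g) (S.mat g))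
      map_one' := by simp
      map_mul' := fun g h => by
        simp [mul_kronecker_mul, submatrix_mul_equiv] }
  continuous_mat := by
    have hR := R.continuous_mat
    have hS := S.continuous_mat
    refine Continuous.matrix_submatrix ?_ _ _
    refine continuous_matrix fun i j => ?_
    exact (hR.matrix_elem _ _).mul (hS.matrix_elem _ _)

/-- The complex conjugate representation. -/
def conj (R : MatRep G) : MatRep G where
  dim := R.dim
  mat := ((starRingEnd ℂ).mapMatrix : _ →+* Matrix (Fin R.dim) (Fin R.dim) ℂ).toMonoidHom.comp
    R.mat
  continuous_mat := by
    have hR := R.continuous_mat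
    exact continuous_matrix fun i j => Complex.continuous_conj.comp (hR.matrix_elem _ _)

lemma sim_sum (R S : MatRep G) :
    Sim (fun g => fromBlocks (R.mat g) 0 0 (S.mat g)) (R.sum S).mat :=
  Sim.of_reindex finSumFinEquiv fun g i j => by
    change fromBlocks (R.mat g) 0 0 (S.mat g) (finSumFinEquiv.symm (finSumFinEquiv i))
      (finSumFinEquiv.symm (finSumFinEquiv j)) = _
    simp only [Equiv.symm_apply_apply]

lemma sim_tensor (R S : MatRep G) :
    Sim (fun g => kroneckerMap (· * ·) (R.mat g) (S.mat g)) (R.tensor S).mat :=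
  Sim.of_reindex finProdFinEquiv fun g i j => by
    change kroneckerMap (· * ·) (R.mat g) (S.mat g) (finProdFinEquiv.symm (finProdFinEquiv i))
      (finProdFinEquiv.symm (finProdFinEquiv j)) = _
    simp only [Equiv.symm_apply_apply]

lemma sim_refl (R : MatRep G) : Sim R.mat R.mat := ⟨1, 1, by simp, by simp, by simp⟩

lemma sum_congr {R R' S S' : MatRep G} (h : R.Iso R') (h' : S.Iso S') :
    (R.sum S).Iso (R'.sum S') := by
  rw [iso_iff_sim] at *
  exact ((sim_sum R S).symm.trans (h.sum h')).trans (sim_sum R' S')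

lemma tensor_congr {R R' S S' : MatRep G} (h : R.Iso R') (h' : S.Iso S') :
    (R.tensor S).Iso (R'.tensor S') := by
  rw [iso_iff_sim] at *
  exact ((sim_tensor R S).symm.trans (h.kron h')).trans (sim_tensor R' S')

lemma sum_comm_iso (R S : MatRep G) : (R.sum S).Iso (S.sum R) := by
  rw [iso_iff_sim]
  refine ((sim_sum R S).symm.trans (Sim.of_reindex (Equiv.sumComm _ _) ?_)).trans (sim_sum S R)
  rintro g (i | i) (j | j) <;> simp

lemma sum_assoc_iso (R S T : MatRep G) : ((R.sum S).sum T).Iso (R.sum (S.sum T)) := by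
  rw [iso_iff_sim]
  refine ((sim_sum _ T).symm.trans ((sim_sum R S).symm.sum T.sim_refl)).trans
    (Sim.trans ?_ ((R.sim_refl.sum (sim_sum S T)).trans (sim_sum R _)))
  refine Sim.of_reindex (Equiv.sumAssoc _ _ _) ?_
  rintro g ((i | i) | i) ((j | j) | j) <;> simp

lemma zero_sum_iso (R : MatRep G) : ((zero G).sum R).Iso R := by
  rw [iso_iff_sim]
  refine (sim_sum _ R).symm.trans ?_
  have : IsEmpty (Fin (zero G).dim) := Fin.isEmpty
  refine Sim.of_reindex (Equiv.emptySum _ _) ?_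
  rintro g (i | i) (j | j)
  · exact isEmptyElim i
  · exact isEmptyElim i
  · exact isEmptyElim j
  · simp

lemma tensor_comm_iso (R S : MatRep G) : (R.tensor S).Iso (S.tensor R) := by
  rw [iso_iff_sim]
  refine ((sim_tensor R S).symm.trans (Sim.of_reindex (Equiv.prodComm _ _) ?_)).trans
    (sim_tensor S R)
  rintro g ⟨i, i'⟩ ⟨j, j'⟩
  simp [mul_comm]

lemma tensor_assoc_iso (R S T : MatRep G) :
    ((R.tensor S).tensor T).Iso (R.tensor (S.tensor T)) := by
  rw [iso_iff_sim]
  refine ((sim_tensor _ T).symm.trans ((sim_tensor R S).symm.kron T.sim_refl)).trans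
    (Sim.trans ?_ ((R.sim_refl.kron (sim_tensor S T)).trans (sim_tensor R _)))
  refine Sim.of_reindex (Equiv.prodAssoc _ _ _) ?_
  rintro g ⟨⟨i, i'⟩, i''⟩ ⟨⟨j, j'⟩, j''⟩
  simp [mul_assoc]

lemma triv_tensor_iso (R : MatRep G) : ((triv G).tensor R).Iso R := by
  rw [iso_iff_sim]
  refine (sim_tensor _ R).symm.trans ?_
  let _ : Unique (Fin (triv G).dim) := inferInstanceAs (Unique (Fin 1))
  refine Sim.of_reindex (Equiv.uniqueProd _ _) ?_
  rintro g ⟨i, i'⟩ ⟨j, j'⟩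
  obtain rfl : i = j := Subsingleton.elim (α := Fin 1) i j
  have h : (triv G).mat g i i = 1 := Matrix.one_apply_eq (α := ℂ) (n := Fin 1) i
  simp only [kroneckerMap_apply, h, one_mul]
  rfl

lemma zero_tensor_iso (R : MatRep G) : ((zero G).tensor R).Iso (zero G) := by
  rw [iso_iff_sim]
  refine (sim_tensor _ R).symm.trans ?_
  have : IsEmpty (Fin (zero G).dim) := Fin.isEmpty
  exact Sim.of_reindex (Equiv.equivOfIsEmpty _ _) fun g i => isEmptyElim i

lemma sum_tensor_iso (R S T : MatRep G) :
    ((R.sum S).tensor T).Iso ((R.tensor T).sum (S.tensor T)) := by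
  rw [iso_iff_sim]
  refine ((sim_tensor _ T).symm.trans ((sim_sum R S).symm.kron T.sim_refl)).trans
    (Sim.trans ?_ (((sim_tensor R T).sum (sim_tensor S T)).trans (sim_sum _ _)))
  refine Sim.of_reindex (Equiv.sumProdDistrib _ _ _) ?_
  rintro g ⟨i | i, i'⟩ ⟨j | j, j'⟩ <;> simp

end MatRep

/-- Isomorphism classes of finite-dimensional continuous representations. -/
def RepClass (G : Type) [Group G] [TopologicalSpace G] : Type := Quotient (MatRep.setoid G)

namespace RepClass

variable {G : Type} [Group G] [TopologicalSpace G]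

/-- The isomorphism class of a representation. -/
def mk (R : MatRep G) : RepClass G := Quotient.mk _ R

instance : Zero (RepClass G) := ⟨mk (MatRep.zero G)⟩

instance : One (RepClass G) := ⟨mk (MatRep.triv G)⟩

instance : Add (RepClass G) :=
  ⟨Quotient.map₂ MatRep.sum fun _ _ h _ _ h' => MatRep.sum_congr h h'⟩

instance : Mul (RepClass G) :=
  ⟨Quotient.map₂ MatRep.tensor fun _ _ h _ _ h' => MatRep.tensor_congr h h'⟩

/-- Isomorphism classes form a commutative semiring under direct sum and tensor product. -/
instance : CommSemiring (RepClass G) where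
  nsmul := nsmulRec
  npow := npowRec
  add_assoc := by rintro ⟨a⟩ ⟨b⟩ ⟨c⟩; exact Quotient.sound (MatRep.sum_assoc_iso a b c)
  add_comm := by rintro ⟨a⟩ ⟨b⟩; exact Quotient.sound (MatRep.sum_comm_iso a b)
  zero_add := by rintro ⟨a⟩; exact Quotient.sound (MatRep.zero_sum_iso a)
  add_zero := by
    rintro ⟨a⟩
    exact Quotient.sound (Setoid.trans (MatRep.sum_comm_iso a _) (MatRep.zero_sum_iso a))
  mul_assoc := by rintro ⟨a⟩ ⟨b⟩ ⟨c⟩; exact Quotient.sound (MatRep.tensor_assoc_iso a b c)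
  mul_comm := by rintro ⟨a⟩ ⟨b⟩; exact Quotient.sound (MatRep.tensor_comm_iso a b)
  one_mul := by rintro ⟨a⟩; exact Quotient.sound (MatRep.triv_tensor_iso a)
  mul_one := by
    rintro ⟨a⟩
    exact Quotient.sound (Setoid.trans (MatRep.tensor_comm_iso a _) (MatRep.triv_tensor_iso a))
  zero_mul := by rintro ⟨a⟩; exact Quotient.sound (MatRep.zero_tensor_iso a)
  mul_zero := by
    rintro ⟨a⟩
    exact Quotient.sound (Setoid.trans (MatRep.tensor_comm_iso a _) (MatRep.zero_tensor_iso a))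
  right_distrib := by
    rintro ⟨a⟩ ⟨b⟩ ⟨c⟩; exact Quotient.sound (MatRep.sum_tensor_iso a b c)
  left_distrib := by
    rintro ⟨a⟩ ⟨b⟩ ⟨c⟩
    exact Quotient.sound (Setoid.trans (MatRep.tensor_comm_iso a _)
      (Setoid.trans (MatRep.sum_tensor_iso b c a)
        (MatRep.sum_congr (MatRep.tensor_comm_iso b a) (MatRep.tensor_comm_iso c a))))

end RepClass

/-- The Grothendieck ring of the category of finite-dimensional continuous representations of
`G`: the Grothendieck completion of the semiring of isomorphism classes. -/
def RepRing (G : Type) [Group G] [TopologicalSpace G] : Type :=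
  Algebra.GrothendieckAddGroup (RepClass G)

namespace RepRing

variable {G : Type} [Group G] [TopologicalSpace G]

instance : AddCommGroup (RepRing G) :=
  inferInstanceAs (AddCommGroup (Algebra.GrothendieckAddGroup (RepClass G)))

/-- The canonical map from isomorphism classes to the Grothendieck ring. -/
def of : RepClass G →+ RepRing G := Algebra.GrothendieckAddGroup.of

/-- The universal property of the Grothendieck completion. -/
def lift {A : Type} [AddCommGroup A] (f : RepClass G →+ A) : RepRing G →+ A :=
  Algebra.GrothendieckAddGroup.lift f

@[simp]
lemma lift_of {A : Type} [AddCommGroup A] (f : RepClass G →+ A) (x : RepClass G) :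
    lift f (of x) = f x :=
  DFunLike.congr_fun (Algebra.GrothendieckAddGroup.lift.symm_apply_apply f) x

lemma exists_sub (x : RepRing G) : ∃ a b : RepClass G, x = of a - of b := by
  have h := Algebra.GrothendieckAddGroup.lift_apply
    (Algebra.GrothendieckAddGroup.of (M := RepClass G)) x
  have h2 : Algebra.GrothendieckAddGroup.lift
      (Algebra.GrothendieckAddGroup.of (M := RepClass G)) = AddMonoidHom.id _ := by
    apply Algebra.GrothendieckAddGroup.lift.symm.injective
    simp
  rw [h2] at h
  exact ⟨_, _, h⟩

/-- The multiplication induced by the tensor product, as a biadditive map. -/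
def mulHom : RepRing G →+ RepRing G →+ RepRing G :=
  lift
    { toFun := fun a => lift (of.comp (AddMonoidHom.mulLeft a))
      map_zero' := by
        ext x
        obtain ⟨b, c, rfl⟩ := exists_sub x
        simp
      map_add' := fun a a' => by
        ext x
        obtain ⟨b, c, rfl⟩ := exists_sub x
        simp [add_mul]
        abel }

lemma mulHom_of (a b : RepClass G) : mulHom (of a) (of b) = of (a * b) := by
  simp [mulHom]

instance : Mul (RepRing G) := ⟨fun x y => mulHom x y⟩

instance : One (RepRing G) := ⟨of 1⟩

instance : CommRing (RepRing G) where
  __ := (inferInstance : AddCommGroup (RepRing G))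
  npow := npowRec
  natCast := Nat.unaryCast
  left_distrib x y z := map_add (mulHom x) y z
  right_distrib x y z := by
    change mulHom (x + y) z = mulHom x z + mulHom y z
    simp
  zero_mul x := by
    change mulHom 0 x = 0
    simp
  mul_zero x := map_zero (mulHom x)
  mul_assoc x y z := by
    change mulHom (mulHom x y) z = mulHom x (mulHom y z)
    obtain ⟨a, b, rfl⟩ := exists_sub x
    obtain ⟨c, d, rfl⟩ := exists_sub y
    obtain ⟨e, f, rfl⟩ := exists_sub z
    simp only [map_sub, AddMonoidHom.sub_apply, mulHom_of, mul_assoc]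
  one_mul x := by
    change mulHom (of 1) x = x
    obtain ⟨a, b, rfl⟩ := exists_sub x
    simp only [map_sub, mulHom_of, one_mul]
  mul_one x := by
    change mulHom x (of 1) = x
    obtain ⟨a, b, rfl⟩ := exists_sub x
    simp only [map_sub, AddMonoidHom.sub_apply, mulHom_of, mul_one]
  mul_comm x y := by
    change mulHom x y = mulHom y x
    obtain ⟨a, b, rfl⟩ := exists_sub x
    obtain ⟨c, d, rfl⟩ := exists_sub y
    simp only [map_sub, AddMonoidHom.sub_apply, mulHom_of, mul_comm]
    abel

/-- The class `[R]` of a representation in the Grothendieck ring. -/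
def cls (R : MatRep G) : RepRing G := of (RepClass.mk R)

end RepRing

/-! ## The group `SU(N)`, its Lie algebra and its Haar measure -/

/-- The special unitary group. -/
abbrev SU (N : ℕ) : Type := Matrix.specialUnitaryGroup (Fin N) ℂ

namespace SU

variable {N : ℕ}

instance : IsTopologicalGroup (SU N) where
  continuous_inv := by
    refine Continuous.subtype_mk (f := fun U : SU N => star (U : Matrix (Fin N) (Fin N) ℂ)) ?_ _
    exact continuous_star.comp continuous_subtype_val

instance : SecondCountableTopology (SU N) :=
  haveI : SecondCountableTopology (Matrix (Fin N) (Fin N) ℂ) :=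
    inferInstanceAs (SecondCountableTopology (Fin N → Fin N → ℂ))
  TopologicalSpace.Subtype.secondCountableTopology _

instance : CompactSpace (SU N) := by
  suffices h : IsCompact (Matrix.specialUnitaryGroup (Fin N) ℂ : Set (Matrix (Fin N) (Fin N) ℂ)) from
    isCompact_iff_compactSpace.mp h
  have hK : IsCompact (Set.pi Set.univ fun _ : Fin N => Set.pi Set.univ fun _ : Fin N =>
      Metric.closedBall (0 : ℂ) 1) :=
    isCompact_univ_pi fun _ => isCompact_univ_pi fun _ => isCompact_closedBall _ _
  refine IsCompact.of_isClosed_subset hK ?_ ?_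
  · have : (Matrix.specialUnitaryGroup (Fin N) ℂ : Set (Matrix (Fin N) (Fin N) ℂ)) =
        {A | A * star A = 1} ∩ {A | A.det = 1} := by
      ext A
      simp [Matrix.mem_specialUnitaryGroup_iff, Matrix.mem_unitaryGroup_iff]
    rw [this]
    exact (isClosed_eq (by fun_prop) continuous_const).inter
      (isClosed_eq (by fun_prop) continuous_const)
  · intro A hA i _ j _
    rw [mem_closedBall_zero_iff]
    exact entry_norm_bound_of_unitary (Matrix.mem_specialUnitaryGroup_iff.mp hA).1 i j

instance : MeasurableSpace (SU N) := borel _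

instance : BorelSpace (SU N) := ⟨rfl⟩

/-- The normalized Haar measure on `SU(N)`. -/
def haar (N : ℕ) : Measure (SU N) := Measure.haarMeasure ⊤

instance : IsProbabilityMeasure (haar N) :=
  ⟨by simpa [haar] using Measure.haarMeasure_self (K₀ := (⊤ : TopologicalSpace.PositiveCompacts (SU N)))⟩

instance : (haar N).IsHaarMeasure := Measure.isHaarMeasure_haarMeasure _

end SU

/-- The Lie algebra `𝔰𝔲(N)` of traceless anti-Hermitian matrices, as a real vector space. -/
def su (N : ℕ) : Submodule ℝ (Matrix (Fin N) (Fin N) ℂ) where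
  carrier := {X | Xᴴ = -X ∧ X.trace = 0}
  zero_mem' := by simp
  add_mem' := by
    rintro X Y ⟨h1, h2⟩ ⟨h3, h4⟩
    exact ⟨by rw [conjTranspose_add, h1, h3]; abel, by rw [trace_add, h2, h4, add_zero]⟩
  smul_mem' := by
    rintro c X ⟨h1, h2⟩
    exact ⟨by rw [conjTranspose_smul, h1]; simp, by rw [trace_smul, h2, smul_zero]⟩

namespace su

variable {N : ℕ}

lemma det_exp {X : Matrix (Fin N) (Fin N) ℂ} (hX : X ∈ su N) :
    (NormedSpace.exp X).det = 1 := by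
  have hH : (Complex.I • X).IsHermitian := by
    rw [Matrix.IsHermitian, conjTranspose_smul, hX.1]
    simp
  obtain ⟨U, D, hU, hXD⟩ : ∃ (U : Matrix (Fin N) (Fin N) ℂ) (D : Fin N → ℂ), IsUnit U ∧
      X = U * diagonal D * U⁻¹ := by
    refine ⟨hH.eigenvectorUnitary, fun i => -Complex.I * hH.eigenvalues i, ?_, ?_⟩
    · exact (Unitary.toUnits hH.eigenvectorUnitary).isUnit
    · have h := hH.spectral_theorem
      rw [Unitary.conjStarAlgAut_apply] at h
      have h2 : -Complex.I • (Complex.I • X) = X := by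
        rw [smul_smul]; simp
      refine h2.symm.trans ((congrArg (fun Y => -Complex.I • Y) h).trans ?_)
      have h3 : (hH.eigenvectorUnitary : Matrix (Fin N) (Fin N) ℂ)⁻¹ =
          star (hH.eigenvectorUnitary : Matrix (Fin N) (Fin N) ℂ) :=
        Matrix.inv_eq_right_inv (Unitary.coe_mul_star_self _)
      rw [h3, ← Matrix.smul_mul, ← Matrix.mul_smul]
      congr 2
      ext i j
      by_cases hij : i = j
      · subst hij; simp
      · simp [hij]
  have htr : ∑ i, D i = 0 := by
    have := hX.2
    rw [hXD, Matrix.trace_mul_comm, ← Matrix.mul_assoc,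
      Matrix.nonsing_inv_mul _ ((Matrix.isUnit_iff_isUnit_det _).mp hU), Matrix.one_mul,
      Matrix.trace_diagonal] at this
    exact this
  rw [hXD, Matrix.exp_conj _ _ hU, Matrix.det_conj hU, Matrix.exp_diagonal, Matrix.det_diagonal]
  have : ∀ i, (NormedSpace.exp D) i = Complex.exp (D i) := fun i => by
    rw [Pi.coe_exp, Complex.exp_eq_exp_ℂ]
  simp_rw [this]
  rw [← Complex.exp_sum, htr, Complex.exp_zero]

/-- The one-parameter subgroup `t ↦ exp (t X)` of `SU(N)`. -/
def exp (X : su N) (t : ℝ) : SU N :=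
  ⟨NormedSpace.exp (t • (X : Matrix (Fin N) (Fin N) ℂ)), by
    have hmem : t • (X : Matrix (Fin N) (Fin N) ℂ) ∈ su N := (su N).smul_mem t X.2
    rw [Matrix.mem_specialUnitaryGroup_iff, Matrix.mem_unitaryGroup_iff]
    refine ⟨?_, det_exp hmem⟩
    rw [star_eq_conjTranspose, ← Matrix.exp_conjTranspose, hmem.1, Matrix.exp_neg]
    exact Matrix.mul_nonsing_inv _ ((Matrix.isUnit_iff_isUnit_det _).mp (Matrix.isUnit_exp _))⟩

lemma exp_zero (X : su N) : exp X 0 = 1 := by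
  apply Subtype.ext
  simp [exp]

lemma exp_add (X : su N) (s t : ℝ) : exp X (s + t) = exp X s * exp X t := by
  apply Subtype.ext
  change NormedSpace.exp _ = NormedSpace.exp _ * NormedSpace.exp _
  rw [add_smul]
  exact Matrix.exp_add_of_commute _ _ ((Commute.refl _).smul_left s |>.smul_right t)

lemma continuous_exp (X : su N) : Continuous (exp X) := by
  refine Continuous.subtype_mk ?_ _
  let _ : NormedRing (Matrix (Fin N) (Fin N) ℂ) := Matrix.linftyOpNormedRing
  let _ : NormedAlgebra ℝ (Matrix (Fin N) (Fin N) ℂ) := Matrix.linftyOpNormedAlgebra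
  let _ : NormedAlgebra ℚ (Matrix (Fin N) (Fin N) ℂ) := NormedAlgebra.restrictScalars ℚ ℝ _
  exact (NormedSpace.exp_continuous (𝔸 := Matrix (Fin N) (Fin N) ℂ)).comp (by fun_prop)

/-- The invariant symmetric bilinear form `(X, Y) ↦ Tr (X Y)` on `𝔰𝔲(N)` (its values are real). -/
def form (N : ℕ) : LinearMap.BilinForm ℝ (su N) :=
  LinearMap.mk₂ ℝ (fun X Y => (((X : Matrix (Fin N) (Fin N) ℂ) *
      (Y : Matrix (Fin N) (Fin N) ℂ)).trace).re)
    (fun X X' Y => by simp [add_mul])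
    (fun c X Y => by simp)
    (fun X Y Y' => by simp [mul_add])
    (fun c X Y => by simp)

lemma form_isSymm : (form N).IsSymm :=
  ⟨fun X Y => by simp [form, Matrix.trace_mul_comm (X : Matrix (Fin N) (Fin N) ℂ)]⟩

open ComplexOrder in
lemma form_nondegenerate : (form N).Nondegenerate := by
  have key : ∀ X : su N, form N X X = 0 → X = 0 := by
    intro X h
    have h1 : (X : Matrix (Fin N) (Fin N) ℂ) * X = -((X : Matrix (Fin N) (Fin N) ℂ)ᴴ * X) := by
      rw [X.2.1]; simp
    have h2 : (((X : Matrix (Fin N) (Fin N) ℂ)ᴴ * X).trace).re = 0 := by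
      have : form N X X = (((X : Matrix (Fin N) (Fin N) ℂ) * X).trace).re := rfl
      rw [this, h1] at h
      simpa using h
    have h3 : ((X : Matrix (Fin N) (Fin N) ℂ)ᴴ * X).trace = 0 := by
      have hp := (Matrix.posSemidef_conjTranspose_mul_self
        (X : Matrix (Fin N) (Fin N) ℂ)).trace_nonneg
      exact Complex.ext h2 (Complex.le_def.mp hp).2.symm
    exact Subtype.ext (Matrix.trace_conjTranspose_mul_self_eq_zero_iff.mp h3)
  exact ⟨fun X h => key X (h X), fun X h => key X (h X)⟩

end su

section OneParameter

open intervalIntegral in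
/-- A continuous one-parameter group in a Banach algebra is differentiable. -/
lemma differentiable_of_oneParam {A : Type} [NormedRing A] [NormedAlgebra ℝ A] [CompleteSpace A]
    {φ : ℝ → A} (hc : Continuous φ) (h0 : φ 0 = 1) (hadd : ∀ s t, φ (s + t) = φ s * φ t) :
    Differentiable ℝ φ := by
  set M : ℝ → A := fun a => ∫ s in (0 : ℝ)..a, φ s with hM
  have hMd : ∀ x, HasDerivAt M (φ x) x := fun x =>
    integral_hasDerivAt_right (hc.intervalIntegrable _ _)
      (hc.stronglyMeasurableAtFilter _ _) hc.continuousAt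
  obtain ⟨a, ha0, hu⟩ : ∃ a : ℝ, a ≠ 0 ∧ IsUnit (a⁻¹ • M a) := by
    have h1 : Filter.Tendsto (fun a : ℝ => a⁻¹ • M a) (nhdsWithin 0 {0}ᶜ) (nhds 1) := by
      have := (hMd 0).tendsto_slope_zero
      simpa [hM, h0] using this
    have h2 : ∀ᶠ a in nhdsWithin (0 : ℝ) {0}ᶜ, IsUnit (a⁻¹ • M a) :=
      h1.eventually (Units.isOpen.mem_nhds isUnit_one)
    obtain ⟨a, h3, h4⟩ := (h2.and self_mem_nhdsWithin).exists
    exact ⟨a, h4, h3⟩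
  obtain ⟨B, hB⟩ : ∃ B, M a * B = 1 := by
    obtain ⟨u, hu⟩ := hu
    refine ⟨a⁻¹ • (↑u⁻¹ : A), ?_⟩
    rw [mul_smul_comm, ← smul_mul_assoc, ← hu]
    simp
  have key : ∀ t, φ t = (M (t + a) - M t) * B := by
    intro t
    have : φ t * M a = M (t + a) - M t := by
      have h := (ContinuousLinearMap.mul ℝ A (φ t)).intervalIntegral_comp_comm
        (hc.intervalIntegrable (μ := volume) 0 a)
      simp only [ContinuousLinearMap.mul_apply'] at h
      rw [hM]
      simp only
      rw [← h]
      simp_rw [← hadd]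
      rw [intervalIntegral.integral_comp_add_left (fun x => φ x) t, add_zero,
        intervalIntegral.integral_interval_sub_left (hc.intervalIntegrable _ _)
          (hc.intervalIntegrable _ _)]
    rw [← this, mul_assoc, hB, mul_one]
  intro t
  have h1 : HasDerivAt (fun t => (M (t + a) - M t) * B) ((φ (t + a) - φ t) * B) t :=
    (((hMd (t + a)).comp_add_const t a).sub (hMd t)).mul_const B
  have h2 : φ = fun t => (M (t + a) - M t) * B := funext key
  rw [h2]
  exact h1.differentiableAt

end OneParameter

/-! ## The quadratic Casimir operator -/

namespace MatRep

variable {N : ℕ}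

/-- The derived representation `dR(X) = d/dt R(exp (t X))` at `t = 0` of `𝔰𝔲(N)`. -/
def deriv (R : MatRep (SU N)) (X : su N) : Matrix (Fin R.dim) (Fin R.dim) ℂ :=
  Matrix.of fun i j => _root_.deriv (fun t : ℝ => R.mat (su.exp X t) i j) 0

/-- The quadratic Casimir operator `∑ᵢ dR(Xᵢ) dR(Xⁱ)`, with `Xᵢ` a basis of `𝔰𝔲(N)` and `Xⁱ` the
dual basis for the form `Tr (X Y)`; equivalently `-∑ₐ dR(Tₐ)²` for a basis `Tₐ` that is
orthonormal for `-Tr (X Y)`. In the fundamental representation it is `N - 1 / N`. -/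
def casimir (R : MatRep (SU N)) : Matrix (Fin R.dim) (Fin R.dim) ℂ :=
  ∑ i, R.deriv (Module.finBasis ℝ (su N) i) *
    R.deriv ((su.form N).dualBasis su.form_nondegenerate (Module.finBasis ℝ (su N)) i)

/-- The quadratic Casimir invariant `C₂(R)`: the normalized trace of the Casimir operator, hence
the scalar by which it acts if `R` is irreducible. -/
def C2 (R : MatRep (SU N)) : ℝ := R.casimir.trace.re / R.dim

/-- The propagator `exp (-(g² a / 2) Ω)` of Yang–Mills theory with coupling `g` over a region of
area `a`, where `Ω` is the Casimir operator: the mean of `R(b)` for the holonomy fluctuation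
`b` accumulated over this region. -/
def heat (g a : ℝ) (R : MatRep (SU N)) : Matrix (Fin R.dim) (Fin R.dim) ℂ :=
  NormedSpace.exp (-((g ^ 2 * a / 2 : ℝ) : ℂ) • R.casimir)

lemma differentiableAt_mat (R : MatRep (SU N)) (X : su N) (i j : Fin R.dim) (t : ℝ) :
    DifferentiableAt ℝ (fun t : ℝ => R.mat (su.exp X t) i j) t := by
  let _ : NormedRing (Matrix (Fin R.dim) (Fin R.dim) ℂ) := Matrix.linftyOpNormedRing
  let _ : NormedAlgebra ℝ (Matrix (Fin R.dim) (Fin R.dim) ℂ) := Matrix.linftyOpNormedAlgebra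
  have hcomp : CompleteSpace (Matrix (Fin R.dim) (Fin R.dim) ℂ) :=
    FiniteDimensional.complete ℝ _
  have h := differentiable_of_oneParam (A := Matrix (Fin R.dim) (Fin R.dim) ℂ)
    (φ := fun t => R.mat (su.exp X t)) (R.continuous_mat.comp (su.continuous_exp X))
    (by rw [su.exp_zero, map_one]) (fun s t => by rw [su.exp_add, map_mul]) t
  let L : Matrix (Fin R.dim) (Fin R.dim) ℂ →ₗ[ℝ] ℂ :=
    { toFun := fun M => M i j
      map_add' := fun _ _ => rfl
      map_smul' := fun _ _ => rfl }
  exact (LinearMap.toContinuousLinearMap L).differentiableAt.comp t h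

lemma deriv_conj {R S : MatRep (SU N)} {P : Matrix (Fin S.dim) (Fin R.dim) ℂ}
    {Q : Matrix (Fin R.dim) (Fin S.dim) ℂ} (h : ∀ g, S.mat g = P * R.mat g * Q) (X : su N) :
    S.deriv X = P * R.deriv X * Q := by
  ext i j
  have h1 : (fun t : ℝ => S.mat (su.exp X t) i j) =
      fun t => ∑ l, (∑ k, P i k * R.mat (su.exp X t) k l) * Q l j := by
    funext t
    rw [h]
    simp [Matrix.mul_apply]
  have hd : ∀ k l, HasDerivAt (fun t : ℝ => R.mat (su.exp X t) k l) (R.deriv X k l) 0 :=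
    fun k l => (R.differentiableAt_mat X k l 0).hasDerivAt
  have h2 : HasDerivAt (fun t : ℝ => ∑ l, (∑ k, P i k * R.mat (su.exp X t) k l) * Q l j)
      (∑ l, (∑ k, P i k * R.deriv X k l) * Q l j) 0 :=
    HasDerivAt.fun_sum fun l _ =>
      (HasDerivAt.fun_sum fun k _ => (hd k l).const_mul (P i k)).mul_const (Q l j)
  change _root_.deriv (fun t : ℝ => S.mat (su.exp X t) i j) 0 = _
  rw [h1, h2.deriv]
  simp [Matrix.mul_apply]

lemma casimir_conj {R S : MatRep (SU N)} {P : Matrix (Fin S.dim) (Fin R.dim) ℂ}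
    {Q : Matrix (Fin R.dim) (Fin S.dim) ℂ} (hQP : Q * P = 1)
    (h : ∀ g, S.mat g = P * R.mat g * Q) : S.casimir = P * R.casimir * Q := by
  simp only [casimir, deriv_conj h, Matrix.mul_sum, Matrix.sum_mul]
  refine Finset.sum_congr rfl fun i _ => ?_
  simp only [Matrix.mul_assoc]
  rw [← Matrix.mul_assoc Q P, hQP, Matrix.one_mul]

lemma exp_conj_rect {m n : ℕ} {P : Matrix (Fin m) (Fin n) ℂ} {Q : Matrix (Fin n) (Fin m) ℂ}
    (hPQ : P * Q = 1) (hQP : Q * P = 1) (A : Matrix (Fin n) (Fin n) ℂ) :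
    NormedSpace.exp (P * A * Q) = P * NormedSpace.exp A * Q := by
  let f : Matrix (Fin n) (Fin n) ℂ →+* Matrix (Fin m) (Fin m) ℂ :=
    { toFun := fun B => P * B * Q
      map_one' := by rw [Matrix.mul_one, hPQ]
      map_mul' := fun B C => by
        simp only [Matrix.mul_assoc]
        rw [← Matrix.mul_assoc Q P, hQP, Matrix.one_mul]
      map_zero' := by simp
      map_add' := fun B C => by rw [Matrix.mul_add, Matrix.add_mul] }
  let _ : NormedRing (Matrix (Fin n) (Fin n) ℂ) := Matrix.linftyOpNormedRing
  let _ : NormedAlgebra ℂ (Matrix (Fin n) (Fin n) ℂ) := Matrix.linftyOpNormedAlgebra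
  let _ : NormedAlgebra ℚ (Matrix (Fin n) (Fin n) ℂ) := NormedAlgebra.restrictScalars ℚ ℂ _
  let _ : NormedRing (Matrix (Fin m) (Fin m) ℂ) := Matrix.linftyOpNormedRing
  let _ : NormedAlgebra ℂ (Matrix (Fin m) (Fin m) ℂ) := Matrix.linftyOpNormedAlgebra
  let _ : NormedAlgebra ℚ (Matrix (Fin m) (Fin m) ℂ) := NormedAlgebra.restrictScalars ℚ ℂ _
  have hf : Continuous f :=
    (continuous_const.matrix_mul continuous_id).matrix_mul continuous_const
  exact (NormedSpace.map_exp f hf A).symm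

lemma heat_conj (g a : ℝ) {R S : MatRep (SU N)} {P : Matrix (Fin S.dim) (Fin R.dim) ℂ}
    {Q : Matrix (Fin R.dim) (Fin S.dim) ℂ} (hPQ : P * Q = 1) (hQP : Q * P = 1)
    (h : ∀ g, S.mat g = P * R.mat g * Q) : S.heat g a = P * R.heat g a * Q := by
  rw [heat, casimir_conj hQP h, heat, ← exp_conj_rect hPQ hQP]
  simp

lemma deriv_sum (R S : MatRep (SU N)) (X : su N) :
    (R.sum S).deriv X = reindex finSumFinEquiv finSumFinEquiv
      (fromBlocks (R.deriv X) 0 0 (S.deriv X)) := by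
  ext i j
  obtain ⟨i, rfl⟩ := finSumFinEquiv.surjective i
  obtain ⟨j, rfl⟩ := finSumFinEquiv.surjective j
  have h : (fun t : ℝ => (R.sum S).mat (su.exp X t) (finSumFinEquiv i) (finSumFinEquiv j)) =
      fun t : ℝ => fromBlocks (R.mat (su.exp X t)) 0 0 (S.mat (su.exp X t)) i j := by
    funext t
    change fromBlocks (R.mat (su.exp X t)) 0 0 (S.mat (su.exp X t))
      (finSumFinEquiv.symm (finSumFinEquiv i)) (finSumFinEquiv.symm (finSumFinEquiv j)) = _
    simp only [Equiv.symm_apply_apply]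
  change _root_.deriv (fun t : ℝ => (R.sum S).mat (su.exp X t) (finSumFinEquiv i)
    (finSumFinEquiv j)) 0 = _
  rw [h]
  simp only [reindex_apply, submatrix_apply, Equiv.symm_apply_apply]
  rcases i with i | i <;> rcases j with j | j <;> simp [deriv]

lemma reindex_block_mul {m n : ℕ} (A A' : Matrix (Fin m) (Fin m) ℂ)
    (B B' : Matrix (Fin n) (Fin n) ℂ) :
    reindex finSumFinEquiv finSumFinEquiv (fromBlocks A 0 0 B) *
      reindex finSumFinEquiv finSumFinEquiv (fromBlocks A' 0 0 B') =
    reindex finSumFinEquiv finSumFinEquiv (fromBlocks (A * A') 0 0 (B * B')) := by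
  simp [fromBlocks_multiply, submatrix_mul_equiv]

lemma reindex_block_smul {m n : ℕ} (c : ℂ) (A : Matrix (Fin m) (Fin m) ℂ)
    (B : Matrix (Fin n) (Fin n) ℂ) :
    c • reindex finSumFinEquiv finSumFinEquiv (fromBlocks A 0 0 B) =
      reindex finSumFinEquiv finSumFinEquiv (fromBlocks (c • A) 0 0 (c • B)) := by
  rw [← coe_reindexLinearEquiv ℂ ℂ, ← map_smul, fromBlocks_smul]
  simp

lemma casimir_sum (R S : MatRep (SU N)) :
    (R.sum S).casimir = reindex finSumFinEquiv finSumFinEquiv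
      (fromBlocks R.casimir 0 0 S.casimir) := by
  have hs : ∀ (s : Finset (Fin (Module.finrank ℝ (su N))))
      (f : _ → Matrix (Fin R.dim) (Fin R.dim) ℂ) (f' : _ → Matrix (Fin S.dim) (Fin S.dim) ℂ),
      ∑ i ∈ s, fromBlocks (f i) 0 0 (f' i) = fromBlocks (∑ i ∈ s, f i) 0 0 (∑ i ∈ s, f' i) := by
    intro s f f'
    ext i j
    rcases i with i | i <;> rcases j with j | j <;> simp [Matrix.sum_apply]
  rw [casimir, casimir, casimir, ← hs]
  simp only [deriv_sum]
  rw [← coe_reindexLinearEquiv ℂ ℂ, map_sum]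
  refine Finset.sum_congr rfl fun i _ => ?_
  exact reindex_block_mul _ _ _ _

lemma heat_sum (g a : ℝ) (R S : MatRep (SU N)) :
    (R.sum S).heat g a = reindex finSumFinEquiv finSumFinEquiv
      (fromBlocks (R.heat g a) 0 0 (S.heat g a)) := by
  let f : Matrix (Fin R.dim) (Fin R.dim) ℂ × Matrix (Fin S.dim) (Fin S.dim) ℂ →+*
      Matrix (Fin (R.dim + S.dim)) (Fin (R.dim + S.dim)) ℂ :=
    { toFun := fun B => reindex finSumFinEquiv finSumFinEquiv (fromBlocks B.1 0 0 B.2)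
      map_one' := by simp
      map_mul' := fun B C => by simp [fromBlocks_multiply, submatrix_mul_equiv]
      map_zero' := by simp
      map_add' := fun B C => by
        rw [← coe_reindexLinearEquiv ℂ ℂ, ← map_add]
        simp [fromBlocks_add] }
  let _ : NormedRing (Matrix (Fin R.dim) (Fin R.dim) ℂ) := Matrix.linftyOpNormedRing
  let _ : NormedAlgebra ℂ (Matrix (Fin R.dim) (Fin R.dim) ℂ) := Matrix.linftyOpNormedAlgebra
  let _ : NormedAlgebra ℚ (Matrix (Fin R.dim) (Fin R.dim) ℂ) :=
    NormedAlgebra.restrictScalars ℚ ℂ _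
  let _ : NormedRing (Matrix (Fin S.dim) (Fin S.dim) ℂ) := Matrix.linftyOpNormedRing
  let _ : NormedAlgebra ℂ (Matrix (Fin S.dim) (Fin S.dim) ℂ) := Matrix.linftyOpNormedAlgebra
  let _ : NormedAlgebra ℚ (Matrix (Fin S.dim) (Fin S.dim) ℂ) :=
    NormedAlgebra.restrictScalars ℚ ℂ _
  let _ : NormedRing (Matrix (Fin (R.dim + S.dim)) (Fin (R.dim + S.dim)) ℂ) :=
    Matrix.linftyOpNormedRing
  let _ : NormedAlgebra ℂ (Matrix (Fin (R.dim + S.dim)) (Fin (R.dim + S.dim)) ℂ) :=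
    Matrix.linftyOpNormedAlgebra
  let _ : NormedAlgebra ℚ (Matrix (Fin (R.dim + S.dim)) (Fin (R.dim + S.dim)) ℂ) :=
    NormedAlgebra.restrictScalars ℚ ℂ _
  have hf : Continuous f :=
    Continuous.matrix_submatrix (Continuous.matrix_fromBlocks continuous_fst continuous_const
      continuous_const continuous_snd) finSumFinEquiv.symm finSumFinEquiv.symm
  have h := NormedSpace.map_exp f hf
    (-((g ^ 2 * a / 2 : ℝ) : ℂ) • R.casimir, -((g ^ 2 * a / 2 : ℝ) : ℂ) • S.casimir)
  have h1 : NormedSpace.exp (-((g ^ 2 * a / 2 : ℝ) : ℂ) • R.casimir,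
      -((g ^ 2 * a / 2 : ℝ) : ℂ) • S.casimir) = (R.heat g a, S.heat g a) :=
    Prod.ext (Prod.fst_exp _) (Prod.snd_exp _)
  refine Eq.trans ?_ (h.symm.trans (congrArg f h1))
  rw [heat, casimir_sum]
  congr 1
  exact reindex_block_smul _ _ _

end MatRep

/-! ## Correlators of Wilson loops and topological point operators -/

/-- The direction of a Wilson loop that runs along the boundary of a surface. -/
inductive LoopDir
  /-- against the orientation induced on the boundary -/
  | opposite
  /-- along the orientation induced on the boundary -/
  | along

/-- The holonomy along the loop, given the holonomy `U` against the boundary orientation. -/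
def LoopDir.hol {N : ℕ} : LoopDir → SU N → SU N
  | .opposite, U => U
  | .along, U => U⁻¹

/-- The holonomy data of a connection on a surface of genus `p` with one boundary circle and
one puncture: the parallel transport from the base point to the puncture and the holonomies
around the handles. -/
abbrev HolData (N p : ℕ) : Type := SU N × (Fin p → SU N × SU N)

/-- The normalized Haar measure on the holonomy data. -/
def holMeasure (N p : ℕ) : Measure (HolData N p) :=
  (SU.haar N).prod (Measure.pi fun _ => (SU.haar N).prod (SU.haar N))

/-- The boundary holonomy `h⁻¹ U h [A₁, B₁] ⋯ [A_p, B_p]`, when the holonomy around the puncture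
is `U` up to conjugation; the fluctuation of the holonomy over the area of the surface is accounted
for by `MatRep.heat`. -/
def boundaryHol {N p : ℕ} (U : SU N) (z : HolData N p) : SU N :=
  z.1⁻¹ * U * z.1 * (List.ofFn fun i => (z.2 i).1 * (z.2 i).2 * (z.2 i).1⁻¹ * (z.2 i).2⁻¹).prod

/-- The correlator `⟨V[U] W_R⟩` of two-dimensional `SU(N)` Yang–Mills theory with coupling `g` on
a surface of area `a` and genus `p` with one boundary circle, along which the Wilson loop `W_R`
runs, and with the operator `V[U]` inserted at an interior point: there the holonomy of the
connection is prescribed to lie in the conjugacy class of `U`. The disk of area `1 / 2` is the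
case `p = 0`, `a = 1 / 2`. -/
def corrRep {N : ℕ} (g a : ℝ) (p : ℕ) (d : LoopDir) (U : SU N) (R : MatRep (SU N)) : ℂ :=
  ∫ z : HolData N p, (R.mat (d.hol (boundaryHol U z)) * R.heat g a).trace ∂(holMeasure N p)

section

variable {N : ℕ} (g a : ℝ) (p : ℕ) (d : LoopDir)

lemma continuous_boundaryHol (U : SU N) :
    Continuous fun z : HolData N p => boundaryHol U z := by
  unfold boundaryHol
  refine Continuous.mul (by fun_prop) ?_
  simp only [List.ofFn_eq_map]
  exact continuous_list_prod _ fun i _ => by fun_prop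

lemma integrable_corr (U : SU N) (R : MatRep (SU N)) :
    Integrable (fun z : HolData N p => (R.mat (d.hol (boundaryHol U z)) * R.heat g a).trace)
      (holMeasure N p) := by
  have hc : Continuous fun z : HolData N p =>
      (R.mat (d.hol (boundaryHol U z)) * R.heat g a).trace := by
    have h1 : Continuous fun z : HolData N p => d.hol (boundaryHol U z) := by
      cases d
      · exact continuous_boundaryHol p U
      · exact (continuous_boundaryHol p U).inv
    have h2 := R.continuous_mat.comp h1
    exact Continuous.matrix_trace (h2.matrix_mul continuous_const)
  have hfin : IsFiniteMeasure (holMeasure N p) := by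
    unfold holMeasure
    infer_instance
  exact hc.integrable_of_hasCompactSupport (HasCompactSupport.of_compactSpace _)

lemma corrRep_iso (U : SU N) {R S : MatRep (SU N)} (h : R.Iso S) :
    corrRep g a p d U R = corrRep g a p d U S := by
  obtain ⟨P, Q, h1, h2, h3⟩ := MatRep.iso_iff_sim.mp h
  have h4 : ∀ g, S.mat g = P * R.mat g * Q := fun g => Sim.eq_conj h1 (h3 g)
  unfold corrRep
  refine congrArg _ (funext fun z => ?_)
  rw [MatRep.heat_conj g a h1 h2 h4, h4]
  set A := R.mat (d.hol (boundaryHol U z))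
  set B := R.heat g a
  have : P * A * Q * (P * B * Q) = P * (A * B * Q) := by
    simp only [Matrix.mul_assoc]
    rw [← Matrix.mul_assoc Q P, h2, Matrix.one_mul]
  rw [this, Matrix.trace_mul_comm P, Matrix.mul_assoc, h2, Matrix.mul_one]

lemma corrRep_zero (U : SU N) : corrRep g a p d U (MatRep.zero (SU N)) = 0 := by
  have : IsEmpty (Fin (MatRep.zero (SU N)).dim) := Fin.isEmpty
  simp [corrRep, Matrix.trace]

lemma corrRep_sum (U : SU N) (R S : MatRep (SU N)) :
    corrRep g a p d U (R.sum S) = corrRep g a p d U R + corrRep g a p d U S := by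
  unfold corrRep
  rw [← integral_add (integrable_corr g a p d U R) (integrable_corr g a p d U S)]
  refine congrArg _ (funext fun z => ?_)
  rw [MatRep.heat_sum]
  change ((reindex finSumFinEquiv finSumFinEquiv (fromBlocks (R.mat _) 0 0 (S.mat _))) *
    reindex finSumFinEquiv finSumFinEquiv _).trace = _
  have htr : ∀ M : Matrix (Fin R.dim ⊕ Fin S.dim) (Fin R.dim ⊕ Fin S.dim) ℂ,
      (M.submatrix finSumFinEquiv.symm finSumFinEquiv.symm).trace = M.trace := fun M =>
    Equiv.sum_comp finSumFinEquiv.symm fun i => M i i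
  simp only [reindex_apply, submatrix_mul_equiv, fromBlocks_multiply, htr]
  simp [Matrix.trace]

lemma corrRep_conj (k U : SU N) (R : MatRep (SU N)) :
    corrRep g a p d (k * U * k⁻¹) R = corrRep g a p d U R := by
  have hinv : (holMeasure N p).IsMulLeftInvariant := by
    have h1 : ((SU.haar N).prod (SU.haar N)).IsMulLeftInvariant := inferInstance
    have h2 : (Measure.pi fun _ : Fin p =>
        (SU.haar N).prod (SU.haar N)).IsMulLeftInvariant := Measure.pi.isMulLeftInvariant _
    exact Measure.prod.instIsMulLeftInvariant
  unfold corrRep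
  rw [← integral_mul_left_eq_self (fun z : HolData N p =>
    (R.mat (d.hol (boundaryHol U z)) * R.heat g a).trace) (k⁻¹, 1)]
  refine congrArg _ (funext fun z => ?_)
  have : boundaryHol (k * U * k⁻¹) z = boundaryHol U ((k⁻¹, 1) * z) := by
    simp [boundaryHol, mul_assoc]
  rw [this]

/-- The correlator `⟨V[U] W_R⟩` as a function of the isomorphism class of `R`. -/
def corrClass (U : SU N) : RepClass (SU N) →+ ℂ where
  toFun := Quotient.lift (corrRep g a p d U) fun _ _ h => corrRep_iso g a p d U h
  map_zero' := corrRep_zero g a p d U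
  map_add' := by
    rintro ⟨R⟩ ⟨S⟩
    exact corrRep_sum g a p d U R S

lemma corrClass_conj (k U : SU N) :
    corrClass g a p d (k * U * k⁻¹) = corrClass g a p d U := by
  refine DFunLike.ext _ _ ?_
  rintro ⟨R⟩
  exact corrRep_conj g a p d k U R

/-- The pairing `⟨c, x⟩ = ⟨V[c] W_x⟩` between conjugacy classes of `SU(N)`, which label the
topological point operators, and the Grothendieck ring, whose elements label the Wilson loops:
the additive extension of the correlator `corrRep`. -/
def corr (c : ConjClasses (SU N)) : RepRing (SU N) →+ ℂ :=
  RepRing.lift (Quotient.lift (corrClass g a p d) (fun U U' h => by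
    obtain ⟨k, rfl⟩ := isConj_iff.mp h
    exact (corrClass_conj g a p d k U).symm) c)

/-- The pairing `⟨x | y⟩` on the Grothendieck ring, obtained by integrating over the insertions
of topological point operators. -/
def pairing (x y : RepRing (SU N)) : ℂ :=
  ∫ U, corr g a p d (ConjClasses.mk U) x * corr g a p d (ConjClasses.mk U) y ∂(SU.haar N)

/-- Gauging the non-invertible 1-form symmetry with generalized theta-angle `κ`: the
integral over the insertions of all topological point operators `V[U]`, weighted by the
character of `κ`. -/
def gauged (κ : MatRep (SU N)) (x : RepRing (SU N)) : ℂ :=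
  ∫ U, κ.char U * corr g a p d (ConjClasses.mk U) x ∂(SU.haar N)

end

/-- The weight `(dim R)^(-2p) exp (-(g² a / 2) C₂(R))` of the sector `R` on a surface of area `a`
and genus `p` with one boundary circle. -/
def weight {N : ℕ} (g a : ℝ) (p : ℕ) (R : MatRep (SU N)) : ℝ :=
  ((R.dim : ℝ) ^ (2 * p))⁻¹ * Real.exp (-(g ^ 2 * a / 2) * R.C2)

/-- The representation selected by gauging with theta-angle `κ`. -/
def LoopDir.selected {N : ℕ} : LoopDir → MatRep (SU N) → MatRep (SU N)
  | .opposite, κ => κ.conj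
  | .along, κ => κ

end YM

end

open YM

/-
By the Lie product formula the derivative of a representation is linear, so the Casimir operator
does not depend on the basis and commutes with the representation; on an irreducible one it is
a scalar by Schur's lemma, real because the representation can be made unitary. The heat kernel
is then a scalar as well. Averaging over the group turns `R(ABA⁻¹B⁻¹)` into `(dim R)⁻²`, once per
handle, so the correlator of an irreducible Wilson loop is its character times its weight, and
the orthogonality of characters evaluates the pairing and the gauging. Complete reducibility makes
the irreducible classes generate the Grothendieck ring, which extends these identities by
additivity. Divided by the weight of `κ`, the gauging takes integer values: these are
the multiplicities of the selected representation, and they are the coefficients of the projector.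
-/

noncomputable section

namespace YM

section PowerLimit

open Filter Topology

lemma norm_pow_succ_sub_pow_succ_le {A : Type*} [NormedRing A] {u v : A} {M : ℝ}
    (hu : ‖u‖ ≤ M) (hv : ‖v‖ ≤ M) (n : ℕ) :
    ‖u ^ (n + 1) - v ^ (n + 1)‖ ≤ (n + 1) * M ^ n * ‖u - v‖ := by
  have hM : 0 ≤ M := (norm_nonneg u).trans hu
  induction n with
  | zero => simp
  | succ n ih =>
    have hpow : ‖v ^ (n + 1)‖ ≤ M ^ (n + 1) :=
      (norm_pow_le' v n.succ_pos).trans (pow_le_pow_left₀ (norm_nonneg v) hv _)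
    calc ‖u ^ (n + 2) - v ^ (n + 2)‖
        = ‖u * (u ^ (n + 1) - v ^ (n + 1)) + (u - v) * v ^ (n + 1)‖ := by
          rw [pow_succ' u (n + 1), pow_succ' v (n + 1), mul_sub, sub_mul, sub_add_sub_cancel]
      _ ≤ ‖u‖ * ‖u ^ (n + 1) - v ^ (n + 1)‖ + ‖u - v‖ * ‖v ^ (n + 1)‖ :=
          (norm_add_le _ _).trans (add_le_add (norm_mul_le _ _) (norm_mul_le _ _))
      _ ≤ M * ((n + 1) * M ^ n * ‖u - v‖) + ‖u - v‖ * M ^ (n + 1) := by gcongr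
      _ = ((n + 1 : ℕ) + 1) * M ^ (n + 1) * ‖u - v‖ := by push_cast; ring

lemma eventually_norm_le_exp_of_hasDerivAt {A : Type*} [NormedRing A] [NormedAlgebra ℝ A]
    (hone : ‖(1 : A)‖ ≤ 1) {γ : ℝ → A} {Z : A} (h0 : γ 0 = 1) (hγ : HasDerivAt γ Z 0) :
    ∀ᶠ s in 𝓝[>] 0, ‖γ s‖ ≤ Real.exp ((‖Z‖ + 1) * s) := by
  have hlin : ∀ᶠ s in 𝓝 (0 : ℝ), ‖γ s - 1 - s • Z‖ ≤ |s| := by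
    simpa [h0] using (hasDerivAt_iff_isLittleO.mp hγ).def one_pos
  filter_upwards [nhdsWithin_le_nhds hlin, self_mem_nhdsWithin] with s hs hpos
  have hs0 : 0 ≤ s := le_of_lt hpos
  calc ‖γ s‖ = ‖(γ s - 1 - s • Z) + (1 + s • Z)‖ := by congr 1; abel
    _ ≤ |s| + (1 + |s| * ‖Z‖) := by
        refine (norm_add_le _ _).trans (add_le_add hs ((norm_add_le _ _).trans ?_))
        exact add_le_add hone (norm_smul_le _ _)
    _ = (‖Z‖ + 1) * s + 1 := by rw [abs_of_nonneg hs0]; ring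
    _ ≤ Real.exp ((‖Z‖ + 1) * s) := Real.add_one_le_exp _

lemma tendsto_pow_exp_of_hasDerivAt {A : Type*} [NormedRing A] [NormedAlgebra ℝ A]
    [CompleteSpace A] (hone : ‖(1 : A)‖ ≤ 1) {γ : ℝ → A} {Z : A} (h0 : γ 0 = 1)
    (hγ : HasDerivAt γ Z 0) :
    Tendsto (fun n : ℕ => γ (n : ℝ)⁻¹ ^ n) atTop (𝓝 (NormedSpace.exp Z)) := by
  let _ : NormedAlgebra ℚ A := NormedAlgebra.restrictScalars ℚ ℝ A
  set ε : ℝ → A := fun s => NormedSpace.exp (s • Z) with hε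
  have hε0 : ε 0 = 1 := by simp [hε]
  have hεd : HasDerivAt ε Z 0 := by simpa using hasDerivAt_exp_smul_const Z (0 : ℝ)
  have hinv : Tendsto (fun n : ℕ => (n : ℝ)⁻¹) atTop (𝓝[>] 0) :=
    tendsto_inv_atTop_nhdsGT_zero.comp tendsto_natCast_atTop_atTop
  have hdiff : Tendsto (fun n : ℕ => n * ‖γ (n : ℝ)⁻¹ - ε (n : ℝ)⁻¹‖) atTop (𝓝 0) := by
    simpa [Function.comp_def, h0, hε0, norm_smul] using
      (((hγ.sub hεd).tendsto_slope_zero_right).comp hinv).norm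
  rw [tendsto_iff_norm_sub_tendsto_zero]
  refine squeeze_zero' (Eventually.of_forall fun _ => norm_nonneg _) ?_
    (by simpa using hdiff.const_mul (Real.exp (‖Z‖ + 1)))
  filter_upwards [hinv.eventually (eventually_norm_le_exp_of_hasDerivAt hone h0 hγ),
    hinv.eventually (eventually_norm_le_exp_of_hasDerivAt hone hε0 hεd),
    eventually_gt_atTop 0] with n hγn hεn hn
  obtain ⟨m, rfl⟩ : ∃ m, n = m + 1 := ⟨n - 1, by omega⟩
  set M := Real.exp ((‖Z‖ + 1) * ((m + 1 : ℕ) : ℝ)⁻¹)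
  have hexp : ε ((m + 1 : ℕ) : ℝ)⁻¹ ^ (m + 1) = NormedSpace.exp Z := by
    rw [hε, ← NormedSpace.exp_nsmul, ← Nat.cast_smul_eq_nsmul ℝ, smul_smul,
      mul_inv_cancel₀ (by positivity), one_smul]
  have hM : M ^ m ≤ Real.exp (‖Z‖ + 1) := by
    rw [← Real.exp_nat_mul, Real.exp_le_exp, mul_left_comm, ← div_eq_mul_inv]
    exact mul_le_of_le_one_right (by positivity)
      ((div_le_one (by positivity)).mpr (by exact_mod_cast m.le_succ))
  calc ‖γ ((m + 1 : ℕ) : ℝ)⁻¹ ^ (m + 1) - NormedSpace.exp Z‖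
      ≤ (m + 1) * M ^ m * ‖γ ((m + 1 : ℕ) : ℝ)⁻¹ - ε ((m + 1 : ℕ) : ℝ)⁻¹‖ := by
        rw [← hexp]; exact norm_pow_succ_sub_pow_succ_le hγn hεn m
    _ ≤ (m + 1) * Real.exp (‖Z‖ + 1) * ‖γ ((m + 1 : ℕ) : ℝ)⁻¹ - ε ((m + 1 : ℕ) : ℝ)⁻¹‖ := by
        gcongr
    _ = _ := by push_cast; ring

end PowerLimit

section CanonicalElement

variable {K V M ι : Type*} [Field K] [AddCommGroup V] [Module K V] [AddCommGroup M] [Module K M]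
  [Fintype ι] [DecidableEq ι] {B : LinearMap.BilinForm K V} (hB : B.Nondegenerate)
  (b : Module.Basis ι K V)

lemma sum_form_smul_dualBasis (y : V) : ∑ i, B y (b i) • B.dualBasis hB b i = y := by
  simpa only [LinearMap.BilinForm.dualBasis_repr_apply] using (B.dualBasis hB b).sum_repr y

lemma sum_form_dualBasis_smul (x : V) : ∑ i, B (B.dualBasis hB b i) x • b i = x := by
  conv_rhs => rw [← b.sum_repr x]
  refine Finset.sum_congr rfl fun j _ => congrArg (· • b j) ?_
  conv_lhs => rw [← b.sum_repr x]
  simp only [map_sum, map_smul, LinearMap.BilinForm.apply_dualBasis_left]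
  simp

lemma sum_map_dualBasis_of_isometry (β : V →ₗ[K] V →ₗ[K] M) (T : V ≃ₗ[K] V)
    (hT : ∀ x y, B (T x) (T y) = B x y) :
    ∑ i, β (T (b i)) (T (B.dualBasis hB b i)) = ∑ i, β (b i) (B.dualBasis hB b i) := by
  set c := B.dualBasis hB b
  have hinv (i : ι) : ∑ j, B (T (c j)) (b i) • T (b j) = b i := by
    have hadj (j : ι) : B (T (c j)) (b i) = B (c j) (T.symm (b i)) := by
      conv_lhs => rw [← T.apply_symm_apply (b i)]
      exact hT _ _
    simp only [hadj, ← map_smul, ← map_sum, c, sum_form_dualBasis_smul, T.apply_symm_apply]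
  calc ∑ j, β (T (b j)) (T (c j))
      = ∑ j, ∑ i, B (T (c j)) (b i) • β (T (b j)) (c i) := by
        refine Finset.sum_congr rfl fun j _ => ?_
        conv_lhs => rw [← sum_form_smul_dualBasis hB b (T (c j))]
        simp only [map_sum, map_smul, c]
    _ = ∑ i, β (∑ j, B (T (c j)) (b i) • T (b j)) (c i) := by
        rw [Finset.sum_comm]
        simp only [map_sum, map_smul, LinearMap.sum_apply, LinearMap.smul_apply]
    _ = ∑ i, β (b i) (c i) := by simp only [hinv]

end CanonicalElement

namespace su

variable {N : ℕ}

lemma coe_mul_coe_inv (U : SU N) : (U : Matrix (Fin N) (Fin N) ℂ) * (U⁻¹ : SU N) = 1 :=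
  congrArg Subtype.val (mul_inv_cancel U)

lemma coe_inv_mul_coe (U : SU N) : ((U⁻¹ : SU N) : Matrix (Fin N) (Fin N) ℂ) * U = 1 :=
  congrArg Subtype.val (inv_mul_cancel U)

lemma mul_mul_inv_mem (U : SU N) {X : Matrix (Fin N) (Fin N) ℂ} (hX : X ∈ su N) :
    (U : Matrix (Fin N) (Fin N) ℂ) * X * (U⁻¹ : SU N) ∈ su N := by
  constructor
  · change ((U : Matrix (Fin N) (Fin N) ℂ) * X * (U : Matrix (Fin N) (Fin N) ℂ)ᴴ)ᴴ =
      -((U : Matrix (Fin N) (Fin N) ℂ) * X * (U : Matrix (Fin N) (Fin N) ℂ)ᴴ)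
    simp only [conjTranspose_mul, conjTranspose_conjTranspose, hX.1, Matrix.neg_mul,
      Matrix.mul_neg, Matrix.mul_assoc]
  · rw [Matrix.trace_mul_comm, ← Matrix.mul_assoc, coe_inv_mul_coe, Matrix.one_mul, hX.2]

/-- The adjoint action of `SU(N)` on `𝔰𝔲(N)`. -/
def ad (U : SU N) : su N ≃ₗ[ℝ] su N where
  toFun X := ⟨(U : Matrix (Fin N) (Fin N) ℂ) * (X : Matrix (Fin N) (Fin N) ℂ) * (U⁻¹ : SU N),
    mul_mul_inv_mem U X.2⟩
  map_add' X Y := Subtype.ext (by simp [mul_add, add_mul])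
  map_smul' c X := Subtype.ext (by simp)
  invFun X := ⟨((U⁻¹ : SU N) : Matrix (Fin N) (Fin N) ℂ) * (X : Matrix (Fin N) (Fin N) ℂ) * U, by
    simpa only [inv_inv] using mul_mul_inv_mem U⁻¹ X.2⟩
  left_inv X := Subtype.ext (by
    simp only [Matrix.mul_assoc, coe_inv_mul_coe, Matrix.mul_one]
    rw [← Matrix.mul_assoc, coe_inv_mul_coe, Matrix.one_mul])
  right_inv X := Subtype.ext (by
    simp only [Matrix.mul_assoc, coe_mul_coe_inv, Matrix.mul_one]
    rw [← Matrix.mul_assoc, coe_mul_coe_inv, Matrix.one_mul])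

lemma coe_ad (U : SU N) (X : su N) :
    (ad U X : Matrix (Fin N) (Fin N) ℂ) = U * X * (U⁻¹ : SU N) := rfl

lemma form_ad (U : SU N) (X Y : su N) : form N (ad U X) (ad U Y) = form N X Y := by
  change (Matrix.trace ((ad U X).1 * (ad U Y).1)).re = (Matrix.trace (X.1 * Y.1)).re
  rw [coe_ad, coe_ad, ← Matrix.mul_assoc, Matrix.trace_mul_comm]
  simp only [← Matrix.mul_assoc, coe_inv_mul_coe, Matrix.one_mul]
  rw [Matrix.mul_assoc X.1, coe_inv_mul_coe, Matrix.mul_one]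

lemma exp_ad (U : SU N) (X : su N) (t : ℝ) : exp (ad U X) t = U * exp X t * U⁻¹ := by
  apply Subtype.ext
  change NormedSpace.exp (t • (ad U X : Matrix (Fin N) (Fin N) ℂ)) =
    U * NormedSpace.exp (t • (X : Matrix (Fin N) (Fin N) ℂ)) * (U⁻¹ : SU N)
  rw [← MatRep.exp_conj_rect (coe_mul_coe_inv U) (coe_inv_mul_coe U), coe_ad, Matrix.mul_smul,
    Matrix.smul_mul]

lemma exp_smul (c : ℝ) (X : su N) (t : ℝ) : exp (c • X) t = exp X (t * c) := by
  apply Subtype.ext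
  change NormedSpace.exp (t • c • (X : Matrix (Fin N) (Fin N) ℂ)) =
    NormedSpace.exp ((t * c) • (X : Matrix (Fin N) (Fin N) ℂ))
  rw [smul_smul]

end su

section OneParameterSubgroups

attribute [local instance] Matrix.linftyOpNormedRing Matrix.linftyOpNormedAlgebra

open Filter Topology

lemma norm_one_matrix_le (n : ℕ) : ‖(1 : Matrix (Fin n) (Fin n) ℂ)‖ ≤ 1 := by
  rcases isEmpty_or_nonempty (Fin n) with h | h
  · rw [Subsingleton.elim (1 : Matrix (Fin n) (Fin n) ℂ) 0, norm_zero]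
    exact zero_le_one
  · have : NormOneClass (Matrix (Fin n) (Fin n) ℂ) := Matrix.linfty_opNormOneClass
    exact norm_one.le

lemma hasDerivAt_exp_smul_zero {n : ℕ} (X : Matrix (Fin n) (Fin n) ℂ) :
    HasDerivAt (fun t : ℝ => NormedSpace.exp (t • X)) X 0 := by
  have : CompleteSpace (Matrix (Fin n) (Fin n) ℂ) := FiniteDimensional.complete ℝ _
  have h := hasDerivAt_exp_smul_const (𝕂 := ℝ) X (0 : ℝ)
  simp only [zero_smul, NormedSpace.exp_zero, one_mul] at h
  exact h

namespace su

variable {N : ℕ}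

lemma tendsto_exp_mul_exp_pow (X Y : su N) :
    Tendsto (fun n : ℕ => (exp X (n : ℝ)⁻¹ * exp Y (n : ℝ)⁻¹) ^ n) atTop
      (𝓝 (exp (X + Y) 1)) := by
  have : CompleteSpace (Matrix (Fin N) (Fin N) ℂ) := FiniteDimensional.complete ℝ _
  have hXY := (hasDerivAt_exp_smul_zero (X : Matrix (Fin N) (Fin N) ℂ)).mul
    (hasDerivAt_exp_smul_zero (Y : Matrix (Fin N) (Fin N) ℂ))
  simp only [zero_smul, NormedSpace.exp_zero, mul_one, one_mul] at hXY
  have hlim := tendsto_pow_exp_of_hasDerivAt (norm_one_matrix_le N) (by simp) hXY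
  rw [tendsto_subtype_rng]
  change Tendsto _ _ (𝓝 (NormedSpace.exp ((1 : ℝ) • ((X : Matrix (Fin N) (Fin N) ℂ) + Y))))
  rw [one_smul]
  exact hlim

end su

namespace MatRep

variable {N : ℕ} (R : MatRep (SU N))

lemma hasDerivAt_mat_exp (X : su N) :
    HasDerivAt (fun t : ℝ => R.mat (su.exp X t)) (R.deriv X) 0 := by
  have hentry (i j : Fin R.dim) :
      HasDerivAt (fun t : ℝ => R.mat (su.exp X t) i j) (R.deriv X i j) 0 :=
    (R.differentiableAt_mat X i j 0).hasDerivAt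
  exact hasDerivAt_pi.mpr fun i => hasDerivAt_pi.mpr (hentry i)

lemma deriv_smul (c : ℝ) (X : su N) : R.deriv (c • X) = c • R.deriv X := by
  have hX := R.hasDerivAt_mat_exp X
  rw [← zero_mul c] at hX
  have hc : HasDerivAt (fun t : ℝ => t * c) c 0 := hasDerivAt_mul_const c
  refine (R.hasDerivAt_mat_exp (c • X)).unique ?_
  simp only [su.exp_smul]
  exact hX.scomp 0 hc

lemma mat_exp_add_one (X Y : su N) :
    R.mat (su.exp (X + Y) 1) = NormedSpace.exp (R.deriv X + R.deriv Y) := by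
  have : CompleteSpace (Matrix (Fin R.dim) (Fin R.dim) ℂ) := FiniteDimensional.complete ℝ _
  have hXY := (R.hasDerivAt_mat_exp X).mul (R.hasDerivAt_mat_exp Y)
  simp only [su.exp_zero, map_one, mul_one, one_mul] at hXY
  refine tendsto_nhds_unique
    ((R.continuous_mat.tendsto _).comp (su.tendsto_exp_mul_exp_pow X Y)) ?_
  refine (tendsto_pow_exp_of_hasDerivAt (norm_one_matrix_le R.dim) (by simp [su.exp_zero])
    hXY).congr fun n => ?_
  simp only [Function.comp_apply, map_pow, map_mul, Pi.mul_apply]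

lemma deriv_add (X Y : su N) : R.deriv (X + Y) = R.deriv X + R.deriv Y := by
  have hexp (t : ℝ) :
      R.mat (su.exp (X + Y) t) = NormedSpace.exp (t • (R.deriv X + R.deriv Y)) := by
    rw [smul_add, ← deriv_smul, ← deriv_smul, ← mat_exp_add_one, ← smul_add, su.exp_smul, one_mul]
  refine (R.hasDerivAt_mat_exp (X + Y)).unique ?_
  simp only [hexp]
  exact hasDerivAt_exp_smul_zero _

/-- The derived representation as a linear map on `𝔰𝔲(N)`. -/
def derivLinear : su N →ₗ[ℝ] Matrix (Fin R.dim) (Fin R.dim) ℂ where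
  toFun := R.deriv
  map_add' := R.deriv_add
  map_smul' := R.deriv_smul

lemma deriv_ad (U : SU N) (X : su N) :
    R.deriv (su.ad U X) = R.mat U * R.deriv X * R.mat U⁻¹ := by
  refine (R.hasDerivAt_mat_exp (su.ad U X)).unique ?_
  simp only [su.exp_ad, map_mul]
  exact ((R.hasDerivAt_mat_exp X).const_mul (R.mat U)).mul_const (R.mat U⁻¹)

lemma mat_mul_mat_inv {G : Type} [Group G] [TopologicalSpace G] (R : MatRep G) (g : G) :
    R.mat g * R.mat g⁻¹ = 1 := by
  rw [← map_mul, mul_inv_cancel, map_one]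

lemma mat_inv_mul_mat {G : Type} [Group G] [TopologicalSpace G] (R : MatRep G) (g : G) :
    R.mat g⁻¹ * R.mat g = 1 := by
  rw [← map_mul, inv_mul_cancel, map_one]

lemma commute_casimir_mat (U : SU N) : Commute (R.mat U) R.casimir := by
  have hconj : R.mat U * R.casimir * R.mat U⁻¹ = R.casimir := by
    have hmul (A B : Matrix (Fin R.dim) (Fin R.dim) ℂ) :
        R.mat U * (A * B) * R.mat U⁻¹ =
          R.mat U * A * R.mat U⁻¹ * (R.mat U * B * R.mat U⁻¹) := by
      simp only [Matrix.mul_assoc]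
      rw [← Matrix.mul_assoc (R.mat U⁻¹) (R.mat U), mat_inv_mul_mat, Matrix.one_mul]
    simp only [casimir, Matrix.mul_sum, Matrix.sum_mul, hmul, ← deriv_ad]
    exact sum_map_dualBasis_of_isometry su.form_nondegenerate _
      ((LinearMap.mul ℝ _).compl₁₂ R.derivLinear R.derivLinear) (su.ad U) (su.form_ad U)
  change R.mat U * R.casimir = R.casimir * R.mat U
  conv_rhs => rw [← hconj]
  rw [Matrix.mul_assoc (R.mat U * R.casimir), mat_inv_mul_mat, Matrix.mul_one]

end MatRep

end OneParameterSubgroups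

section MatrixIntegral

attribute [local instance] Matrix.normedAddCommGroup Matrix.normedSpace

section BochnerIntegral

variable {X : Type*} [TopologicalSpace X] [CompactSpace X] [MeasurableSpace X]
  [OpensMeasurableSpace X] {l m n : Type*} [Fintype l] [Fintype m] [Fintype n]

lemma integrable_of_continuous {E : Type*} [NormedAddCommGroup E] [SecondCountableTopology E]
    {f : X → E} (hf : Continuous f) (μ : Measure X) [IsFiniteMeasure μ] : Integrable f μ :=
  hf.integrable_of_hasCompactSupport (HasCompactSupport.of_compactSpace f)

variable {μ : Measure X} [IsFiniteMeasure μ]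

lemma map_integral_of_continuous {E F : Type*} [NormedAddCommGroup E] [NormedSpace ℂ E]
    [FiniteDimensional ℂ E] [SecondCountableTopology E] [NormedAddCommGroup F] [NormedSpace ℂ F]
    [CompleteSpace F] (L : E →ₗ[ℂ] F) {f : X → E} (hf : Continuous f) :
    L (∫ x, f x ∂μ) = ∫ x, L (f x) ∂μ := by
  have := FiniteDimensional.complete ℂ E
  exact (LinearMap.toContinuousLinearMap L).integral_comp_comm (integrable_of_continuous hf μ)
    |>.symm

lemma mul_integral_matrix (C : Matrix l m ℂ) {F : X → Matrix m n ℂ} (hF : Continuous F) :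
    C * ∫ x, F x ∂μ = ∫ x, C * F x ∂μ := by
  let L : Matrix m n ℂ →ₗ[ℂ] Matrix l n ℂ :=
    { toFun := fun A => C * A
      map_add' := Matrix.mul_add C
      map_smul' := Matrix.mul_smul C }
  exact map_integral_of_continuous L hF

lemma integral_matrix_mul {F : X → Matrix l m ℂ} (hF : Continuous F) (C : Matrix m n ℂ) :
    (∫ x, F x ∂μ) * C = ∫ x, F x * C ∂μ := by
  let L : Matrix l m ℂ →ₗ[ℂ] Matrix l n ℂ :=
    { toFun := fun A => A * C
      map_add' := fun A B => Matrix.add_mul A B C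
      map_smul' := fun c A => Matrix.smul_mul c A C }
  exact map_integral_of_continuous L hF

lemma trace_integral_matrix {F : X → Matrix m m ℂ} (hF : Continuous F) :
    (∫ x, F x ∂μ).trace = ∫ x, (F x).trace ∂μ :=
  map_integral_of_continuous (Matrix.traceLinearMap m ℂ ℂ) hF

lemma integral_matrix_apply {F : X → Matrix m n ℂ} (hF : Continuous F) (i : m) (j : n) :
    (∫ x, F x ∂μ) i j = ∫ x, F x i j ∂μ :=
  map_integral_of_continuous (Matrix.entryLinearMap ℂ ℂ i j) hF

end BochnerIntegral

section CommutatorProduct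

open scoped commutatorElement

/-- The product `⁅A₁, B₁⁆ ⋯ ⁅A_p, B_p⁆`, the holonomy around `p` handles. -/
def commutatorProd {G : Type*} [Group G] {p : ℕ} (z : Fin p → G × G) : G :=
  (List.ofFn fun i => ⁅(z i).1, (z i).2⁆).prod

variable {G : Type*} [Group G] [TopologicalSpace G] [IsTopologicalGroup G]

lemma continuous_commutator : Continuous fun z : G × G => ⁅z.1, z.2⁆ := by
  simp only [commutatorElement_def]
  fun_prop

lemma continuous_commutatorProd (p : ℕ) :
    Continuous fun z : Fin p → G × G => commutatorProd z := by
  simp only [commutatorProd, List.ofFn_eq_map]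
  exact continuous_list_prod _ fun i _ => continuous_commutator.comp (continuous_apply i)

end CommutatorProduct

namespace MatRep

variable {G : Type} [Group G] [TopologicalSpace G] {R S : MatRep G}

section Schur

lemma IsIrreducible.dim_pos (hR : R.IsIrreducible) : 0 < R.dim := by
  refine Nat.pos_of_ne_zero fun h => ?_
  have : IsEmpty (Fin R.dim) := by rw [h]; exact Fin.isEmpty
  have hR' : R.toRep.IsIrreducible := hR
  obtain ⟨W, W', hW⟩ := hR'.toNontrivial
  exact hW (Subrepresentation.toSubmodule_injective (Subsingleton.elim _ _))

lemma IsIrreducible.dim_ne_zero (hR : R.IsIrreducible) : (R.dim : ℂ) ≠ 0 :=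
  Nat.cast_ne_zero.mpr hR.dim_pos.ne'

/-- A matrix that intertwines two representations, as a homomorphism of representations. -/
def intertwiner {M : Matrix (Fin R.dim) (Fin S.dim) ℂ} (hM : ∀ g, R.mat g * M = M * S.mat g) :
    Representation.IntertwiningMap S.toRep R.toRep where
  __ := Matrix.toLin' M
  isIntertwining' g := by
    change Matrix.toLin' M ∘ₗ Matrix.toLin' (S.mat g) = Matrix.toLin' (R.mat g) ∘ₗ Matrix.toLin' M
    rw [← Matrix.toLin'_mul, ← Matrix.toLin'_mul, hM]

lemma eq_zero_of_not_iso (hR : R.IsIrreducible) (hS : S.IsIrreducible) (h : ¬ S.Iso R)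
    {M : Matrix (Fin R.dim) (Fin S.dim) ℂ} (hM : ∀ g, R.mat g * M = M * S.mat g) : M = 0 := by
  have hR' : R.toRep.IsIrreducible := hR
  have hS' : S.toRep.IsIrreducible := hS
  rcases Representation.IsIrreducible.bijective_or_eq_zero (intertwiner hM) with hbij | hzero
  · exact absurd ⟨(intertwiner hM).ofBijective hbij⟩ h
  · exact Matrix.toLin'.injective
      ((congrArg Representation.IntertwiningMap.toLinearMap hzero).trans (map_zero _).symm)

lemma exists_eq_smul_one (hR : R.IsIrreducible) {M : Matrix (Fin R.dim) (Fin R.dim) ℂ}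
    (hM : ∀ g, Commute (R.mat g) M) : ∃ c : ℂ, M = c • 1 := by
  have hR' : R.toRep.IsIrreducible := hR
  obtain ⟨c, hc⟩ :=
    Representation.IsIrreducible.algebraMap_intertwiningMap_bijective_of_isAlgClosed.2
      (intertwiner fun g => (hM g).eq)
  have hlin : c • LinearMap.id = Matrix.toLin' M :=
    congrArg Representation.IntertwiningMap.toLinearMap hc
  refine ⟨c, Matrix.toLin'.injective ?_⟩
  rw [← hlin, map_smul, Matrix.toLin'_one]

lemma eq_trace_div_dim_smul_one (hR : R.IsIrreducible) {M : Matrix (Fin R.dim) (Fin R.dim) ℂ}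
    (hM : ∀ g, Commute (R.mat g) M) : M = (M.trace / R.dim) • 1 := by
  obtain ⟨c, rfl⟩ := exists_eq_smul_one hR hM
  rw [Matrix.trace_smul, Matrix.trace_one, Fintype.card_fin, smul_eq_mul,
    mul_div_cancel_right₀ _ hR.dim_ne_zero]

end Schur

variable (R) in
lemma continuous_char : Continuous R.char := R.continuous_mat.matrix_trace

section Averaging

variable [IsTopologicalGroup G]

lemma continuous_mat_mul_mul_mat_inv (M : Matrix (Fin R.dim) (Fin S.dim) ℂ) :
    Continuous fun g => R.mat g * M * S.mat g⁻¹ :=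
  (R.continuous_mat.matrix_mul continuous_const).matrix_mul
    (S.continuous_mat.comp continuous_inv)

lemma continuous_char_smul_mat_inv : Continuous fun g => R.char g • S.mat g⁻¹ :=
  R.continuous_char.smul (S.continuous_mat.comp continuous_inv)

variable [CompactSpace G] [MeasurableSpace G] [BorelSpace G] (μ : Measure G)

/-- The mean of `R(g) M S(g)⁻¹`, the projection of `M` to the intertwiners from `S` to `R`. -/
def average (R S : MatRep G) (M : Matrix (Fin R.dim) (Fin S.dim) ℂ) :
    Matrix (Fin R.dim) (Fin S.dim) ℂ :=
  ∫ g, R.mat g * M * S.mat g⁻¹ ∂μ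

section FiniteMeasure

variable [IsFiniteMeasure μ]

lemma integral_char_smul_mat_inv_apply (j k : Fin S.dim) :
    (∫ g, R.char g • S.mat g⁻¹ ∂μ) j k =
      ∑ i, average μ R S (Matrix.single i j 1) i k := by
  have hentry (g : G) (i : Fin R.dim) :
      (R.mat g * Matrix.single i j (1 : ℂ) * S.mat g⁻¹) i k = R.mat g i i * S.mat g⁻¹ j k := by
    simp [Matrix.mul_apply, Matrix.single_apply, ite_and]
  simp only [average]
  rw [integral_matrix_apply continuous_char_smul_mat_inv]
  simp only [integral_matrix_apply (continuous_mat_mul_mul_mat_inv _)]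
  rw [← integral_finsetSum _ fun i _ => integrable_of_continuous
    ((continuous_mat_mul_mul_mat_inv _).matrix_elem i k) μ]
  simp only [hentry, ← Finset.sum_mul]
  rfl

lemma trace_integral_char_smul_mat_inv :
    (∫ g, R.char g • S.mat g⁻¹ ∂μ).trace = ∫ g, R.char g * S.char g⁻¹ ∂μ := by
  rw [trace_integral_matrix continuous_char_smul_mat_inv]
  simp only [Matrix.trace_smul, smul_eq_mul]
  rfl

lemma mat_mul_average [μ.IsMulLeftInvariant] (M : Matrix (Fin R.dim) (Fin S.dim) ℂ) (h : G) :
    R.mat h * average μ R S M = average μ R S M * S.mat h := by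
  have hc := continuous_mat_mul_mul_mat_inv (R := R) (S := S) M
  calc R.mat h * average μ R S M
      = ∫ g, R.mat (h * g) * M * S.mat (h * g)⁻¹ * S.mat h ∂μ := by
        rw [average, mul_integral_matrix _ hc]
        refine congrArg _ (funext fun g => ?_)
        rw [_root_.mul_inv_rev, map_mul, map_mul, Matrix.mul_assoc _ _ (S.mat h),
          Matrix.mul_assoc _ _ (S.mat h), mat_inv_mul_mat, Matrix.mul_one]
        simp only [Matrix.mul_assoc]
    _ = (∫ g, R.mat (h * g) * M * S.mat (h * g)⁻¹ ∂μ) * S.mat h :=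
        (integral_matrix_mul (hc.comp (continuous_const.mul continuous_id)) _).symm
    _ = average μ R S M * S.mat h := by
        rw [integral_mul_left_eq_self (fun g => R.mat g * M * S.mat g⁻¹), average]

end FiniteMeasure

variable [IsProbabilityMeasure μ]

lemma trace_average (M : Matrix (Fin R.dim) (Fin R.dim) ℂ) :
    (average μ R R M).trace = M.trace := by
  have hconj (g : G) : (R.mat g * M * R.mat g⁻¹).trace = M.trace := by
    rw [Matrix.trace_mul_comm, ← Matrix.mul_assoc, mat_inv_mul_mat, Matrix.one_mul]
  rw [average, trace_integral_matrix (continuous_mat_mul_mul_mat_inv M)]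
  simp only [hconj, integral_const, probReal_univ, one_smul]

variable [μ.IsMulLeftInvariant]

lemma average_eq_trace_div_dim_smul_one (hR : R.IsIrreducible)
    (M : Matrix (Fin R.dim) (Fin R.dim) ℂ) :
    average μ R R M = (M.trace / R.dim) • 1 := by
  rw [eq_trace_div_dim_smul_one hR (mat_mul_average μ M), trace_average]

lemma average_eq_zero_of_not_iso (hR : R.IsIrreducible) (hS : S.IsIrreducible)
    (h : ¬ S.Iso R) (M : Matrix (Fin R.dim) (Fin S.dim) ℂ) : average μ R S M = 0 :=
  eq_zero_of_not_iso hR hS h (mat_mul_average μ M)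

lemma integral_char_smul_mat_inv (hR : R.IsIrreducible) :
    ∫ g, R.char g • R.mat g⁻¹ ∂μ = (R.dim : ℂ)⁻¹ • 1 := by
  ext j k
  simp only [integral_char_smul_mat_inv_apply, average_eq_trace_div_dim_smul_one μ hR,
    Matrix.smul_apply, Matrix.one_apply, smul_eq_mul, mul_ite, mul_one, mul_zero,
    Finset.sum_ite_eq', Finset.mem_univ, if_true]
  rcases eq_or_ne j k with rfl | hjk
  · simp
  · simp [hjk, Matrix.trace_single_eq_of_ne _ _ _ hjk.symm]

lemma integral_char_smul_mat_inv_of_not_iso (hR : R.IsIrreducible) (hS : S.IsIrreducible)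
    (h : ¬ S.Iso R) : ∫ g, R.char g • S.mat g⁻¹ ∂μ = 0 := by
  ext j k
  simp only [integral_char_smul_mat_inv_apply, average_eq_zero_of_not_iso μ hR hS h,
    Matrix.zero_apply, Finset.sum_const_zero]

theorem integral_char_mul_char_inv (hR : R.IsIrreducible) :
    ∫ g, R.char g * R.char g⁻¹ ∂μ = 1 := by
  rw [← trace_integral_char_smul_mat_inv, integral_char_smul_mat_inv μ hR, Matrix.trace_smul,
    Matrix.trace_one, Fintype.card_fin, smul_eq_mul, inv_mul_cancel₀ hR.dim_ne_zero]

theorem integral_char_mul_char_inv_of_not_iso (hR : R.IsIrreducible) (hS : S.IsIrreducible)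
    (h : ¬ S.Iso R) : ∫ g, R.char g * S.char g⁻¹ ∂μ = 0 := by
  rw [← trace_integral_char_smul_mat_inv, integral_char_smul_mat_inv_of_not_iso μ hR hS h,
    Matrix.trace_zero]

end Averaging

section Commutators

variable [IsTopologicalGroup G]

open scoped commutatorElement

variable [CompactSpace G] [SecondCountableTopology G] [MeasurableSpace G] [BorelSpace G]
  (μ : Measure G) [IsProbabilityMeasure μ] [μ.IsMulLeftInvariant]

theorem integral_mat_commutator (hR : R.IsIrreducible) :
    ∫ z, R.mat ⁅z.1, z.2⁆ ∂(μ.prod μ) = ((R.dim : ℂ) ^ 2)⁻¹ • 1 := by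
  have hinner (B : G) : ∫ A, R.mat ⁅A, B⁆ ∂μ = (R.dim : ℂ)⁻¹ • R.char B • R.mat B⁻¹ := by
    simp only [commutatorElement_def, map_mul]
    rw [← integral_matrix_mul (continuous_mat_mul_mul_mat_inv _), ← average,
      average_eq_trace_div_dim_smul_one μ hR, Matrix.smul_mul, Matrix.one_mul, div_eq_inv_mul,
      mul_smul, char]
  have hc : Continuous fun z : G × G => R.mat ⁅z.1, z.2⁆ :=
    R.continuous_mat.comp continuous_commutator
  rw [integral_prod_symm _ (integrable_of_continuous hc _)]
  simp only [hinner]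
  rw [integral_smul, integral_char_smul_mat_inv μ hR, smul_smul, ← mul_inv, sq]

theorem integral_mat_commutatorProd (hR : R.IsIrreducible) (p : ℕ) :
    ∫ z, R.mat (commutatorProd z) ∂(Measure.pi fun _ : Fin p => μ.prod μ) =
      ((R.dim : ℂ) ^ (2 * p))⁻¹ • 1 := by
  induction p with
  | zero => simp [commutatorProd]
  | succ p ih =>
    have hW : Continuous fun z : Fin p → G × G => R.mat (commutatorProd z) :=
      R.continuous_mat.comp (continuous_commutatorProd p)
    have hVW : Continuous fun y : (G × G) × (Fin p → G × G) =>
        R.mat ⁅y.1.1, y.1.2⁆ * R.mat (commutatorProd y.2) :=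
      (R.continuous_mat.comp (continuous_commutator.comp continuous_fst)).matrix_mul
        (hW.comp continuous_snd)
    have hcons : ∀ z : Fin (p + 1) → G × G, R.mat (commutatorProd z) =
        R.mat ⁅(z 0).1, (z 0).2⁆ * R.mat (commutatorProd fun i => z i.succ) := fun z => by
      rw [← map_mul, commutatorProd, List.ofFn_succ, List.prod_cons, commutatorProd]
    calc ∫ z, R.mat (commutatorProd z) ∂(Measure.pi fun _ : Fin (p + 1) => μ.prod μ)
        = ∫ y, R.mat ⁅y.1.1, y.1.2⁆ * R.mat (commutatorProd y.2)
            ∂((μ.prod μ).prod (Measure.pi fun _ : Fin p => μ.prod μ)) := by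
          simp only [hcons]
          exact (measurePreserving_piFinSuccAbove (fun _ : Fin (p + 1) => μ.prod μ) 0)
            |>.integral_comp' fun y => R.mat ⁅y.1.1, y.1.2⁆ * R.mat (commutatorProd y.2)
      _ = ∫ x, ((R.dim : ℂ) ^ (2 * p))⁻¹ • R.mat ⁅x.1, x.2⁆ ∂(μ.prod μ) := by
          rw [integral_prod _ (integrable_of_continuous hVW _)]
          refine congrArg _ (funext fun x => ?_)
          dsimp only
          rw [← mul_integral_matrix _ hW, ih, Matrix.mul_smul, Matrix.mul_one]
      _ = ((R.dim : ℂ) ^ (2 * (p + 1)))⁻¹ • 1 := by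
          rw [integral_smul, integral_mat_commutator μ hR, smul_smul, ← mul_inv, ← pow_add]
          congr 3

theorem integral_char_mul_commutatorProd (hR : R.IsIrreducible) (p : ℕ) (g : G) :
    ∫ z, R.char (g * commutatorProd z) ∂(Measure.pi fun _ : Fin p => μ.prod μ) =
      R.char g * ((R.dim : ℂ) ^ (2 * p))⁻¹ := by
  have hW : Continuous fun z : Fin p → G × G => R.mat (commutatorProd z) :=
    R.continuous_mat.comp (continuous_commutatorProd p)
  simp only [char, map_mul]
  rw [← trace_integral_matrix (continuous_const.matrix_mul hW), ← mul_integral_matrix _ hW,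
    integral_mat_commutatorProd μ hR, Matrix.mul_smul, Matrix.mul_one, Matrix.trace_smul,
    smul_eq_mul, mul_comm]

end Commutators

end MatRep

end MatrixIntegral

namespace MatRep

section Isomorphism

variable {G : Type} [Group G] [TopologicalSpace G] {R S : MatRep G}

lemma Iso.dim_eq (h : R.Iso S) : R.dim = S.dim := by
  obtain ⟨e⟩ := h
  simpa using e.toLinearEquiv.finrank_eq

lemma char_iso (h : R.Iso S) : R.char = S.char := by
  obtain ⟨P, Q, hPQ, hQP, hP⟩ := iso_iff_sim.mp h
  funext g
  rw [char, char, Sim.eq_conj hPQ (hP g), Matrix.trace_mul_comm, ← Matrix.mul_assoc, hQP,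
    Matrix.one_mul]

lemma zero_iso_of_dim_eq_zero (h : R.dim = 0) : (zero G).Iso R := by
  have : IsEmpty (Fin (zero G).dim) := Fin.isEmpty
  exact iso_iff_sim.mpr (Sim.of_reindex (finCongr h.symm) fun _ i => isEmptyElim i)

variable {k l : ℕ} {A : Matrix (Fin R.dim) (Fin k) ℂ} {B : Matrix (Fin k) (Fin R.dim) ℂ}
  {C : Matrix (Fin R.dim) (Fin l) ℂ} {D : Matrix (Fin l) (Fin R.dim) ℂ}

lemma mul_mat_mul_mul (hBA : B * A = 1) (hAB : ∀ g, Commute (R.mat g) (A * B)) (g : G) :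
    B * R.mat g * A * B = B * R.mat g := by
  rw [Matrix.mul_assoc, Matrix.mul_assoc, (hAB g).eq, ← Matrix.mul_assoc, ← Matrix.mul_assoc, hBA,
    Matrix.one_mul]

/-- The representation `B R(g) A` on the range of an equivariant idempotent `A B`, in the
coordinates of that range given by `B`. -/
def compress (R : MatRep G) {k : ℕ} {A : Matrix (Fin R.dim) (Fin k) ℂ}
    {B : Matrix (Fin k) (Fin R.dim) ℂ} (hBA : B * A = 1)
    (hAB : ∀ g, Commute (R.mat g) (A * B)) : MatRep G where
  dim := k
  mat :=
    { toFun := fun g => B * R.mat g * A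
      map_one' := by rw [map_one, Matrix.mul_one, hBA]
      map_mul' := fun g h => by
        rw [← Matrix.mul_assoc, ← Matrix.mul_assoc, mul_mat_mul_mul hBA hAB, map_mul,
          ← Matrix.mul_assoc] }
  continuous_mat := (continuous_const.matrix_mul R.continuous_mat).matrix_mul continuous_const

lemma iso_compress (hBA : B * A = 1) (hAB : A * B = 1)
    (h : ∀ g, Commute (R.mat g) (A * B)) : R.Iso (R.compress hBA h) :=
  iso_iff_sim.mpr ⟨B, A, hBA, hAB, fun g => (mul_mat_mul_mul hBA h g).symm⟩

lemma iso_sum_compress (hBA : B * A = 1) (hDC : D * C = 1) (hsum : A * B + C * D = 1)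
    (hAB : ∀ g, Commute (R.mat g) (A * B)) (hCD : ∀ g, Commute (R.mat g) (C * D)) :
    R.Iso ((R.compress hBA hAB).sum (R.compress hDC hCD)) := by
  have hBC : B * C = 0 := by
    have h : B * (A * B + C * D) * C = B * C + B * C := by
      rw [Matrix.mul_add, Matrix.add_mul, ← Matrix.mul_assoc, hBA, Matrix.one_mul,
        Matrix.mul_assoc B, Matrix.mul_assoc C, hDC, Matrix.mul_one]
    rwa [hsum, Matrix.mul_one, left_eq_add] at h
  have hDA : D * A = 0 := by
    have h : D * (A * B + C * D) * A = D * A + D * A := by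
      rw [Matrix.mul_add, Matrix.add_mul, ← Matrix.mul_assoc D C, hDC, Matrix.one_mul,
        Matrix.mul_assoc D, Matrix.mul_assoc A, hBA, Matrix.mul_one]
    rwa [hsum, Matrix.mul_one, left_eq_add] at h
  have hsim : Sim R.mat fun g => fromBlocks (B * R.mat g * A) 0 0 (D * R.mat g * C) := by
    refine ⟨fromRows B D, fromCols A C, ?_, (fromCols_mul_fromRows A C B D).trans hsum,
      fun g => ?_⟩
    · rw [fromRows_mul_fromCols, hBA, hDC, hBC, hDA, fromBlocks_one]
    · rw [fromRows_mul, fromBlocks_mul_fromRows, mul_mat_mul_mul hBA hAB,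
        mul_mat_mul_mul hDC hCD, Matrix.zero_mul, Matrix.zero_mul, add_zero, zero_add]
  exact iso_iff_sim.mpr (hsim.trans (sim_sum (R.compress hBA hAB) (R.compress hDC hCD)))

lemma exists_factorization_of_isIdempotentElem {n : ℕ} {E : Matrix (Fin n) (Fin n) ℂ}
    (hE : IsIdempotentElem E) :
    ∃ (k : ℕ) (A : Matrix (Fin n) (Fin k) ℂ) (B : Matrix (Fin k) (Fin n) ℂ),
      A * B = E ∧ B * A = 1 := by
  set e := Matrix.toLin' E with he
  have hee : ∀ v, e (e v) = e v := fun v => by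
    rw [← LinearMap.comp_apply, he, ← Matrix.toLin'_mul, hE.eq]
  let b := Module.finBasis ℂ (LinearMap.range e)
  refine ⟨Module.finrank ℂ (LinearMap.range e),
    LinearMap.toMatrix' ((LinearMap.range e).subtype ∘ₗ b.equivFun.symm.toLinearMap),
    LinearMap.toMatrix' (b.equivFun.toLinearMap ∘ₗ e.rangeRestrict), ?_, ?_⟩
  · rw [← LinearMap.toMatrix'_comp, ← LinearMap.toMatrix'_toLin' E, ← he]
    congr 1
    refine LinearMap.ext fun v => ?_
    simp
  · rw [← LinearMap.toMatrix'_comp, ← LinearMap.toMatrix'_id]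
    congr 1
    refine LinearMap.ext fun v => ?_
    have hfix : e.rangeRestrict (b.equivFun.symm v : Fin n → ℂ) = b.equivFun.symm v := by
      obtain ⟨w, hw⟩ := (b.equivFun.symm v).2
      refine Subtype.ext ?_
      rw [LinearMap.codRestrict_apply, ← hw, hee]
    simp only [LinearMap.comp_apply, LinearEquiv.coe_coe, Submodule.subtype_apply, hfix,
      LinearEquiv.apply_symm_apply, LinearMap.id_apply]

lemma exists_iso_sum_of_isIdempotentElem {E : Matrix (Fin R.dim) (Fin R.dim) ℂ}
    (hE : IsIdempotentElem E) (hc : ∀ g, Commute (R.mat g) E) (h0 : E ≠ 0) (h1 : E ≠ 1) :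
    ∃ S T : MatRep G, R.Iso (S.sum T) ∧ S.dim < R.dim ∧ T.dim < R.dim := by
  obtain ⟨k, A, B, hAB, hBA⟩ := exists_factorization_of_isIdempotentElem hE
  obtain ⟨l, C, D, hCD, hDC⟩ := exists_factorization_of_isIdempotentElem hE.one_sub
  have hcS : ∀ g, Commute (R.mat g) (A * B) := hAB ▸ hc
  have hcT : ∀ g, Commute (R.mat g) (C * D) :=
    fun g => hCD ▸ (Commute.one_right _).sub_right (hc g)
  have hiso : R.Iso ((R.compress hBA hcS).sum (R.compress hDC hcT)) :=
    iso_sum_compress hBA hDC (by rw [hAB, hCD, add_sub_cancel]) hcS hcT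
  have hdim : R.dim = k + l := hiso.dim_eq
  have hk : k ≠ 0 := by
    rintro rfl
    exact h0 (hAB.symm.trans (by ext; simp [Matrix.mul_apply]))
  have hl : l ≠ 0 := by
    rintro rfl
    exact h1 (sub_eq_zero.mp (hCD.symm.trans (by ext; simp [Matrix.mul_apply]))).symm
  refine ⟨_, _, hiso, ?_, ?_⟩
  · change k < R.dim
    lia
  · change l < R.dim
    lia

end Isomorphism

section Conjugate

variable {G : Type} [Group G] [TopologicalSpace G] {R : MatRep G}

variable (R) in
lemma conj_conj : R.conj.conj = R := by
  have h : R.conj.conj.mat = R.mat :=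
    MonoidHom.ext fun g => Matrix.ext fun i j => Complex.conj_conj (R.mat g i j)
  obtain ⟨n, ρ, hρ⟩ := R
  change mk n _ _ = mk n ρ hρ
  congr

lemma char_conj (g : G) : R.conj.char g = star (R.char g) :=
  (AddMonoidHom.map_trace (starRingEnd ℂ) (R.mat g)).symm

variable (R) in
lemma conj_toRep_star (g : G) (v : Fin R.dim → ℂ) :
    R.conj.toRep g (star v) = star (R.toRep g v) := by
  funext i
  change ∑ j, star (R.mat g i j) * star (v j) = star (∑ j, R.mat g i j * v j)
  simp only [star_sum, star_mul']

/-- Entrywise complex conjugation, as a bijection between the subrepresentations of `R` and those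
of the conjugate representation. -/
def subrepresentationConjEquiv (R : MatRep G) :
    Subrepresentation R.toRep ≃o Subrepresentation R.conj.toRep where
  toFun W :=
    { toSubmodule := Submodule.orderIsoMapComap (starLinearEquiv ℂ) W.toSubmodule
      apply_mem_toSubmodule := by
        rintro g _ ⟨v, hv, rfl⟩
        exact ⟨_, W.apply_mem_toSubmodule g hv, (R.conj_toRep_star g v).symm⟩ }
  invFun W :=
    { toSubmodule := (Submodule.orderIsoMapComap (starLinearEquiv ℂ)).symm W.toSubmodule
      apply_mem_toSubmodule := by
        rintro g v hv
        have hmem : R.conj.toRep g (star v) ∈ W.toSubmodule := W.apply_mem_toSubmodule g hv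
        rwa [conj_toRep_star] at hmem }
  left_inv W := Subrepresentation.toSubmodule_injective (OrderIso.symm_apply_apply _ _)
  right_inv W := Subrepresentation.toSubmodule_injective (OrderIso.apply_symm_apply _ _)
  map_rel_iff' {V W} :=
    (Submodule.orderIsoMapComap (starLinearEquiv ℂ (A := Fin R.dim → ℂ))).le_iff_le
      (x := V.toSubmodule) (y := W.toSubmodule)

lemma IsIrreducible.conj (hR : R.IsIrreducible) : R.conj.IsIrreducible :=
  R.subrepresentationConjEquiv.isSimpleOrder_iff.mp hR

end Conjugate

section Maschke

attribute [local instance] Matrix.normedAddCommGroup Matrix.normedSpace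

variable {G : Type} [Group G] [TopologicalSpace G] {R : MatRep G}

lemma exists_projection_onto (W : Submodule ℂ (Fin R.dim → ℂ)) :
    ∃ P : Matrix (Fin R.dim) (Fin R.dim) ℂ, (∀ v, P *ᵥ v ∈ W) ∧ ∀ w ∈ W, P *ᵥ w = w := by
  obtain ⟨q, hq⟩ := LinearMap.exists_leftInverse_of_injective W.subtype (Submodule.ker_subtype W)
  have hP : ∀ v, LinearMap.toMatrix' (W.subtype ∘ₗ q) *ᵥ v = q v := fun v =>
    LinearMap.toMatrix'_mulVec _ v
  exact ⟨_, fun v => hP v ▸ (q v).2,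
    fun w hw => (hP w).trans (congrArg Subtype.val (LinearMap.congr_fun hq ⟨w, hw⟩))⟩

variable [IsTopologicalGroup G] [CompactSpace G]

variable (G) in
lemma exists_haar_probability : ∃ (_ : MeasurableSpace G) (_ : BorelSpace G) (μ : Measure G),
    IsProbabilityMeasure μ ∧ μ.IsHaarMeasure := by
  let _ : MeasurableSpace G := borel G
  have : BorelSpace G := ⟨rfl⟩
  exact ⟨_, this, Measure.haarMeasure ⊤, ⟨Measure.haarMeasure_self (K₀ := ⊤)⟩, inferInstance⟩

theorem exists_equivariant_projection (W : Subrepresentation R.toRep) :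
    ∃ E : Matrix (Fin R.dim) (Fin R.dim) ℂ, (∀ g, Commute (R.mat g) E) ∧
      (∀ v, E *ᵥ v ∈ W.toSubmodule) ∧ ∀ w ∈ W.toSubmodule, E *ᵥ w = w := by
  obtain ⟨_, _, μ, _, _⟩ := exists_haar_probability G
  obtain ⟨P, hmem, hfix⟩ := exists_projection_onto W.toSubmodule
  have hPP : ∀ g, P * (R.mat g * P) = R.mat g * P := fun g => by
    refine Matrix.toLin'.injective (LinearMap.ext fun v => ?_)
    simp only [Matrix.toLin'_mul, LinearMap.comp_apply, Matrix.toLin'_apply]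
    exact hfix _ (W.apply_mem_toSubmodule g (hmem v))
  have hc := continuous_mat_mul_mul_mat_inv (R := R) (S := R) P
  have hPE : P * average μ R R P = average μ R R P := by
    rw [average, mul_integral_matrix P hc]
    exact congrArg _ (funext fun g => by rw [← Matrix.mul_assoc, hPP])
  have hEP : average μ R R P * P = P := by
    have hconst : ∀ g, R.mat g * P * R.mat g⁻¹ * P = P := fun g => by
      rw [Matrix.mul_assoc, Matrix.mul_assoc, hPP, ← Matrix.mul_assoc, mat_mul_mat_inv,
        Matrix.one_mul]
    rw [average, integral_matrix_mul hc P]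
    simp only [hconst, integral_const, probReal_univ, one_smul]
  refine ⟨average μ R R P, mat_mul_average μ P, fun v => ?_, fun w hw => ?_⟩
  · rw [← hPE, ← Matrix.mulVec_mulVec]
    exact hmem _
  · rw [← hfix w hw, Matrix.mulVec_mulVec, hEP]

lemma exists_iso_sum_of_not_isIrreducible (hd : R.dim ≠ 0) (hR : ¬ R.IsIrreducible) :
    ∃ S T : MatRep G, R.Iso (S.sum T) ∧ S.dim < R.dim ∧ T.dim < R.dim := by
  have : Nonempty (Fin R.dim) := Fin.pos_iff_nonempty.mp (Nat.pos_of_ne_zero hd)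
  have hnt : Nontrivial (Subrepresentation R.toRep) :=
    ⟨⊥, ⊤, fun h => bot_ne_top (congrArg Subrepresentation.toSubmodule h)⟩
  obtain ⟨W, hbot, htop⟩ : ∃ W : Subrepresentation R.toRep, W ≠ ⊥ ∧ W ≠ ⊤ := by
    by_contra! hcon
    exact hR ⟨fun W => or_iff_not_imp_left.mpr (hcon W)⟩
  obtain ⟨E, hc, hmem, hfix⟩ := exists_equivariant_projection W
  refine exists_iso_sum_of_isIdempotentElem ?_ hc ?_ ?_
  · refine Matrix.toLin'.injective (LinearMap.ext fun v => ?_)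
    simp only [Matrix.toLin'_mul, LinearMap.comp_apply, Matrix.toLin'_apply]
    exact hfix _ (hmem v)
  · rintro rfl
    refine hbot (Subrepresentation.toSubmodule_injective ((Submodule.eq_bot_iff _).mpr ?_))
    exact fun w hw => (hfix w hw).symm.trans (Matrix.zero_mulVec w)
  · rintro rfl
    refine htop (Subrepresentation.toSubmodule_injective (eq_top_iff.mpr fun v _ => ?_))
    exact Matrix.one_mulVec v ▸ hmem v

end Maschke

section Unitary

attribute [local instance] Matrix.normedAddCommGroup Matrix.normedSpace

open scoped ComplexOrder MatrixOrder

variable {G : Type} [Group G] [TopologicalSpace G] [IsTopologicalGroup G] {R : MatRep G}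

lemma continuous_conjTranspose_mat_inv_mul :
    Continuous fun g => (R.mat g⁻¹)ᴴ * R.mat g⁻¹ :=
  (R.continuous_mat.comp continuous_inv).matrix_conjTranspose.matrix_mul
    (R.continuous_mat.comp continuous_inv)

variable [CompactSpace G]

section Gram

variable [MeasurableSpace G] [BorelSpace G] (μ : Measure G)

/-- The mean of `R(g⁻¹)ᴴ R(g⁻¹)`, an invariant Hermitian form. -/
def gram (μ : Measure G) (R : MatRep G) : Matrix (Fin R.dim) (Fin R.dim) ℂ :=
  ∫ g, (R.mat g⁻¹)ᴴ * R.mat g⁻¹ ∂μ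

variable [IsFiniteMeasure μ]

lemma conjTranspose_mat_mul_gram_mul_mat [μ.IsMulLeftInvariant] (h : G) :
    (R.mat h)ᴴ * gram μ R * R.mat h = gram μ R := by
  have hc := continuous_conjTranspose_mat_inv_mul (R := R)
  rw [gram, mul_integral_matrix _ hc,
    integral_matrix_mul (continuous_const.matrix_mul hc),
    ← integral_mul_left_eq_self (fun g => (R.mat h)ᴴ * ((R.mat g⁻¹)ᴴ * R.mat g⁻¹) * R.mat h) h]
  refine congrArg _ (funext fun g => ?_)
  have hmul : R.mat g⁻¹ = R.mat (h * g)⁻¹ * R.mat h := by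
    rw [← map_mul, _root_.mul_inv_rev, inv_mul_cancel_right]
  rw [hmul, conjTranspose_mul]
  simp only [Matrix.mul_assoc]

lemma star_dotProduct_gram_mulVec (v : Fin R.dim → ℂ) :
    star v ⬝ᵥ (gram μ R *ᵥ v) = ((∫ g, ∑ i, ‖(R.mat g⁻¹ *ᵥ v) i‖ ^ 2 ∂μ : ℝ) : ℂ) := by
  let L : Matrix (Fin R.dim) (Fin R.dim) ℂ →ₗ[ℂ] ℂ :=
    { toFun := fun M => star v ⬝ᵥ (M *ᵥ v)
      map_add' := fun M M' => by rw [Matrix.add_mulVec, dotProduct_add]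
      map_smul' := fun c M => by rw [Matrix.smul_mulVec, dotProduct_smul, RingHom.id_apply] }
  refine (map_integral_of_continuous L continuous_conjTranspose_mat_inv_mul).trans ?_
  rw [← integral_complex_ofReal]
  refine congrArg _ (funext fun g => ?_)
  change star v ⬝ᵥ (((R.mat g⁻¹)ᴴ * R.mat g⁻¹) *ᵥ v) = _
  rw [← Matrix.mulVec_mulVec, Matrix.dotProduct_mulVec, ← Matrix.star_mulVec]
  push_cast
  exact Finset.sum_congr rfl fun i _ => Complex.conj_mul' _

lemma posDef_gram [μ.IsOpenPosMeasure] : (gram μ R).PosDef := by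
  refine .of_dotProduct_mulVec_pos ?_ fun v hv => ?_
  · ext i j
    have hc := continuous_conjTranspose_mat_inv_mul (R := R)
    rw [conjTranspose_apply, gram, integral_matrix_apply hc, integral_matrix_apply hc,
      ← starRingEnd_apply, ← integral_conj]
    refine congrArg _ (funext fun g => ?_)
    exact congrFun₂ (isHermitian_conjTranspose_mul_self (R.mat g⁻¹)).eq i j
  · have hcont : Continuous fun g => ∑ i, ‖(R.mat g⁻¹ *ᵥ v) i‖ ^ 2 := by
      have hmulVec : Continuous fun g => R.mat g⁻¹ *ᵥ v :=
        (R.continuous_mat.comp continuous_inv).matrix_mulVec continuous_const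
      fun_prop
    rw [star_dotProduct_gram_mulVec, Complex.zero_lt_real]
    refine hcont.integral_pos_of_hasCompactSupport_nonneg_nonzero (x := 1)
      (HasCompactSupport.of_compactSpace _) (fun g => by positivity) fun h => hv ?_
    rw [inv_one, map_one, Matrix.one_mulVec,
      Finset.sum_eq_zero_iff_of_nonneg fun i _ => by positivity] at h
    exact funext fun i => by simpa using h i (Finset.mem_univ i)

end Gram

variable (R) in
theorem exists_iso_unitary : ∃ S : MatRep G, R.Iso S ∧ ∀ g, (S.mat g)ᴴ = S.mat g⁻¹ := by
  obtain ⟨_, _, μ, _, _⟩ := exists_haar_probability G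
  obtain ⟨_, ⟨B, rfl⟩, hgram⟩ := CStarAlgebra.isStrictlyPositive_iff_eq_star_mul_self.mp
    (posDef_gram (R := R) μ).isStrictlyPositive
  rw [star_eq_conjTranspose] at hgram
  set A : Matrix (Fin R.dim) (Fin R.dim) ℂ := ↑B⁻¹
  have hBA : (B : Matrix (Fin R.dim) (Fin R.dim) ℂ) * A = 1 := B.mul_inv
  have hAB : A * (B : Matrix (Fin R.dim) (Fin R.dim) ℂ) = 1 := B.inv_mul
  have hcomm : ∀ g, Commute (R.mat g) (A * B) := fun g => hAB ▸ Commute.one_right _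
  refine ⟨_, iso_compress hBA hAB hcomm, fun g => ?_⟩
  refine left_inv_eq_right_inv ?_ (mat_mul_mat_inv (R.compress hBA hcomm) g)
  calc (↑B * R.mat g * A)ᴴ * (↑B * R.mat g * A)
      = Aᴴ * ((R.mat g)ᴴ * gram μ R * R.mat g) * A := by
        simp only [hgram, conjTranspose_mul, Matrix.mul_assoc]
    _ = (↑B * A)ᴴ * (↑B * A) := by
        rw [conjTranspose_mat_mul_gram_mul_mat, hgram]
        simp only [conjTranspose_mul, Matrix.mul_assoc]
    _ = 1 := by rw [hBA, conjTranspose_one, Matrix.one_mul]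

variable (R) in
lemma char_inv (g : G) : R.char g⁻¹ = star (R.char g) := by
  obtain ⟨S, hRS, hS⟩ := R.exists_iso_unitary
  rw [char_iso hRS, char, ← hS, Matrix.trace_conjTranspose, char]

lemma char_eq_char_conj_inv (g : G) : R.char g = R.conj.char g⁻¹ := by
  rw [char_conj, char_inv, star_star]

end Unitary

end MatRep

lemma su.exp_neg {N : ℕ} (X : su N) (t : ℝ) : su.exp (-X) t = (su.exp X t)⁻¹ := by
  rw [← neg_one_smul ℝ X, su.exp_smul, eq_inv_iff_mul_eq_one, ← su.exp_add, mul_neg_one,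
    neg_add_cancel, su.exp_zero]

namespace MatRep

section Casimir

variable {N : ℕ} {R S : MatRep (SU N)}

lemma trace_casimir_iso (h : R.Iso S) : R.casimir.trace = S.casimir.trace := by
  obtain ⟨P, Q, hPQ, hQP, hcomm⟩ := iso_iff_sim.mp h
  rw [casimir_conj hQP fun U => Sim.eq_conj hPQ (hcomm U), Matrix.trace_mul_cycle, hQP,
    Matrix.one_mul]

lemma C2_iso (h : R.Iso S) : R.C2 = S.C2 := by
  rw [C2, C2, trace_casimir_iso h, h.dim_eq]

variable (R)

lemma deriv_neg (X : su N) : R.deriv (-X) = -R.deriv X :=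
  map_neg R.derivLinear X

lemma conjTranspose_deriv_of_unitary (hR : ∀ U, (R.mat U)ᴴ = R.mat U⁻¹) (X : su N) :
    (R.deriv X)ᴴ = -R.deriv X := by
  rw [← deriv_neg]
  ext i j
  have hexp (t : ℝ) : R.mat (su.exp (-X) t) i j = star (R.mat (su.exp X t) j i) := by
    rw [su.exp_neg, ← hR, conjTranspose_apply]
  simp only [deriv, conjTranspose_apply, of_apply, hexp]
  exact (R.differentiableAt_mat X j i 0).hasDerivAt.star.deriv.symm

lemma star_trace_casimir : star R.casimir.trace = R.casimir.trace := by
  obtain ⟨S, hRS, hS⟩ := R.exists_iso_unitary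
  rw [trace_casimir_iso hRS, ← Matrix.trace_conjTranspose, casimir]
  simp only [conjTranspose_sum, conjTranspose_mul, S.conjTranspose_deriv_of_unitary hS,
    neg_mul_neg, Matrix.trace_sum]
  exact Finset.sum_congr rfl fun i _ => Matrix.trace_mul_comm _ _

variable {R}

lemma casimir_eq_smul_one (hR : R.IsIrreducible) : R.casimir = (R.C2 : ℂ) • 1 := by
  have hre : (R.casimir.trace.re : ℂ) = R.casimir.trace :=
    Complex.conj_eq_iff_re.mp R.star_trace_casimir
  rw [C2, Complex.ofReal_div, hre, Complex.ofReal_natCast]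
  exact eq_trace_div_dim_smul_one hR R.commute_casimir_mat

lemma heat_eq_smul_one (hR : R.IsIrreducible) (g a : ℝ) :
    R.heat g a = (Real.exp (-(g ^ 2 * a / 2) * R.C2) : ℂ) • 1 := by
  rw [heat, casimir_eq_smul_one hR, smul_smul, smul_one_eq_diagonal, Matrix.exp_diagonal,
    smul_one_eq_diagonal]
  congr 1
  funext i
  rw [Pi.coe_exp, ← Complex.exp_eq_exp_ℂ]
  push_cast
  rfl

variable (R)

lemma deriv_conj_eq_map (X : su N) : R.conj.deriv X = (R.deriv X).map star :=
  Matrix.ext fun i j => (R.differentiableAt_mat X i j 0).hasDerivAt.star.deriv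

lemma casimir_conj_eq_map : R.conj.casimir = R.casimir.map star := by
  have hmap := map_sum (starRingEnd ℂ).mapMatrix (fun i => R.deriv (Module.finBasis ℝ (su N) i) *
    R.deriv ((su.form N).dualBasis su.form_nondegenerate (Module.finBasis ℝ (su N)) i)) .univ
  simp only [map_mul] at hmap
  simp only [casimir, deriv_conj_eq_map]
  exact hmap.symm

lemma C2_conj : R.conj.C2 = R.C2 := by
  have htrace : R.conj.casimir.trace = star R.casimir.trace := by
    rw [casimir_conj_eq_map]
    exact (AddMonoidHom.map_trace (starRingEnd ℂ).toAddMonoidHom R.casimir).symm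
  rw [C2, htrace, star_trace_casimir]
  rfl

end Casimir

end MatRep

section Weight

variable {N : ℕ} (g a : ℝ) (p : ℕ)

lemma weight_iso {R S : MatRep (SU N)} (h : R.Iso S) : weight g a p R = weight g a p S := by
  rw [weight, weight, MatRep.C2_iso h, h.dim_eq]

lemma weight_conj (R : MatRep (SU N)) : weight g a p R.conj = weight g a p R := by
  rw [weight, MatRep.C2_conj]
  rfl

lemma weight_pos {R : MatRep (SU N)} (hR : R.IsIrreducible) : 0 < weight g a p R :=
  mul_pos (inv_pos.mpr (pow_pos (Nat.cast_pos.mpr hR.dim_pos) _)) (Real.exp_pos _)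

end Weight

section GrothendieckRing

variable {G : Type} [Group G] [TopologicalSpace G]

namespace RepRing

lemma cls_iso {R S : MatRep G} (h : R.Iso S) : cls R = cls S :=
  congrArg of (Quotient.sound h)

lemma cls_zero : cls (MatRep.zero G) = 0 :=
  map_zero of

lemma cls_sum (R S : MatRep G) : cls (R.sum S) = cls R + cls S :=
  map_add of (RepClass.mk R) (RepClass.mk S)

variable [IsTopologicalGroup G] [CompactSpace G]

lemma cls_mem_closure_irreducible (R : MatRep G) :
    cls R ∈ AddSubgroup.closure {x | ∃ S : MatRep G, S.IsIrreducible ∧ cls S = x} := by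
  induction hn : R.dim using Nat.strong_induction_on generalizing R with
  | _ n ih =>
    subst hn
    by_cases hR : R.IsIrreducible
    · exact AddSubgroup.subset_closure ⟨R, hR, rfl⟩
    by_cases hd : R.dim = 0
    · rw [← cls_iso (MatRep.zero_iso_of_dim_eq_zero hd), cls_zero]
      exact zero_mem _
    · obtain ⟨S, T, hRST, hS, hT⟩ := MatRep.exists_iso_sum_of_not_isIrreducible hd hR
      rw [cls_iso hRST, cls_sum]
      exact add_mem (ih _ hS S rfl) (ih _ hT T rfl)

variable (G) in
theorem closure_irreducible :
    AddSubgroup.closure {x : RepRing G | ∃ R : MatRep G, R.IsIrreducible ∧ cls R = x} = ⊤ := by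
  refine (AddSubgroup.eq_top_iff' _).mpr fun x => ?_
  obtain ⟨⟨R⟩, ⟨S⟩, rfl⟩ := exists_sub x
  exact sub_mem (cls_mem_closure_irreducible R) (cls_mem_closure_irreducible S)

lemma addMonoidHom_ext {A : Type*} [AddCommGroup A] {f f' : RepRing G →+ A}
    (h : ∀ R : MatRep G, R.IsIrreducible → f (cls R) = f' (cls R)) : f = f' := by
  refine AddMonoidHom.eq_of_eqOn_dense (closure_irreducible G) ?_
  rintro _ ⟨R, hR, rfl⟩
  exact h R hR

lemma induction_irreducible {motive : RepRing G → Prop} (x : RepRing G)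
    (cls : ∀ R : MatRep G, R.IsIrreducible → motive (cls R)) (zero : motive 0)
    (add : ∀ x y, motive x → motive y → motive (x + y)) (neg : ∀ x, motive x → motive (-x)) :
    motive x := by
  have hx : x ∈ AddSubgroup.closure {x | ∃ R : MatRep G, R.IsIrreducible ∧ RepRing.cls R = x} :=
    closure_irreducible G ▸ AddSubgroup.mem_top x
  refine AddSubgroup.closure_induction ?_ zero (fun x y _ _ => add x y) (fun x _ => neg x) hx
  rintro _ ⟨R, hR, rfl⟩
  exact cls R hR

lemma exists_intCast_eq {f : RepRing G →+ ℂ}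
    (hf : ∀ R : MatRep G, R.IsIrreducible → ∃ n : ℤ, f (cls R) = n) :
    ∃ n : RepRing G →+ ℤ, ∀ x, f x = n x := by
  have hint (x : RepRing G) : ∃ n : ℤ, f x = n := by
    induction x using induction_irreducible with
    | cls R hR => exact hf R hR
    | zero => exact ⟨0, by rw [map_zero, Int.cast_zero]⟩
    | add x y hx hy =>
      obtain ⟨⟨m, hm⟩, n, hn⟩ := hx, hy
      exact ⟨m + n, by rw [map_add, hm, hn, Int.cast_add]⟩
    | neg x hx =>
      obtain ⟨n, hn⟩ := hx
      exact ⟨-n, by rw [map_neg, hn, Int.cast_neg]⟩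
  choose n hn using hint
  refine ⟨AddMonoidHom.mk' n fun x y => ?_, hn⟩
  have hadd : (n (x + y) : ℂ) = n x + n y := by rw [← hn, ← hn, ← hn, map_add]
  exact_mod_cast hadd

end RepRing

end GrothendieckRing

namespace LoopDir

variable {N : ℕ} (d : LoopDir) (R : MatRep (SU N))

lemma continuous_hol : Continuous (d.hol : SU N → SU N) := by
  cases d
  · exact continuous_id
  · exact continuous_inv

lemma char_eq_char_selected_conj_hol (U : SU N) :
    R.char U = (d.selected R).conj.char (d.hol U) := by
  cases d
  · exact congrArg (fun S : MatRep (SU N) => S.char U) R.conj_conj.symm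
  · exact R.char_eq_char_conj_inv U

variable {R}

lemma isIrreducible_selected (hR : R.IsIrreducible) : (d.selected R).IsIrreducible := by
  cases d
  · exact hR.conj
  · exact hR

lemma weight_selected (g a : ℝ) (p : ℕ) (R : MatRep (SU N)) :
    weight g a p (d.selected R) = weight g a p R := by
  cases d
  · exact weight_conj g a p R
  · rfl

end LoopDir

section Correlator

variable {N : ℕ} (g a : ℝ) (p : ℕ) (d : LoopDir) {R : MatRep (SU N)}

lemma integral_char_boundaryHol (hR : R.IsIrreducible) (U : SU N) :
    ∫ z, R.char (boundaryHol U z) ∂holMeasure N p = R.char U * ((R.dim : ℂ) ^ (2 * p))⁻¹ := by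
  have hchar (h : SU N) : R.char (h⁻¹ * U * h) = R.char U := by
    rw [MatRep.char, map_mul, map_mul, Matrix.trace_mul_cycle, MatRep.mat_mul_mat_inv,
      Matrix.one_mul, MatRep.char]
  have hhandles (h : SU N) : ∫ z, R.char (boundaryHol U (h, z))
      ∂(Measure.pi fun _ : Fin p => (SU.haar N).prod (SU.haar N)) =
        R.char U * ((R.dim : ℂ) ^ (2 * p))⁻¹ :=
    hchar h ▸ MatRep.integral_char_mul_commutatorProd (SU.haar N) hR p (h⁻¹ * U * h)
  have hcont : Continuous fun z : HolData N p => R.char (boundaryHol U z) :=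
    R.continuous_char.comp (continuous_boundaryHol p U)
  rw [holMeasure, integral_prod _ (integrable_of_continuous hcont _)]
  simp only [hhandles, integral_const, probReal_univ, one_smul]

lemma integral_char_hol_boundaryHol (hR : R.IsIrreducible) (U : SU N) :
    ∫ z, R.char (d.hol (boundaryHol U z)) ∂holMeasure N p =
      R.char (d.hol U) * ((R.dim : ℂ) ^ (2 * p))⁻¹ := by
  cases d
  · exact integral_char_boundaryHol p hR U
  · have hinv (V : SU N) : R.char V⁻¹ = R.conj.char V := by
      rw [R.char_eq_char_conj_inv, inv_inv]
    simp only [LoopDir.hol, hinv]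
    exact integral_char_boundaryHol p hR.conj U

lemma corr_cls (hR : R.IsIrreducible) (U : SU N) :
    corr g a p d (ConjClasses.mk U) (RepRing.cls R) = R.char (d.hol U) * weight g a p R := by
  have htrace (z : HolData N p) : (R.mat (d.hol (boundaryHol U z)) * R.heat g a).trace =
      (Real.exp (-(g ^ 2 * a / 2) * R.C2) : ℂ) * R.char (d.hol (boundaryHol U z)) := by
    rw [MatRep.heat_eq_smul_one hR, Matrix.mul_smul, Matrix.mul_one, Matrix.trace_smul,
      smul_eq_mul, MatRep.char]
  have hcorr : corr g a p d (ConjClasses.mk U) (RepRing.cls R) = corrRep g a p d U R :=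
    RepRing.lift_of _ _
  simp only [hcorr, corrRep, htrace]
  rw [integral_const_mul, integral_char_hol_boundaryHol p d hR, weight]
  push_cast
  ring

lemma continuous_corr (x : RepRing (SU N)) :
    Continuous fun U : SU N => corr g a p d (ConjClasses.mk U) x := by
  induction x using RepRing.induction_irreducible with
  | cls R hR =>
    simp only [corr_cls g a p d hR]
    exact (R.continuous_char.comp d.continuous_hol).mul continuous_const
  | zero =>
    simp only [map_zero]
    exact continuous_const
  | add x y hx hy =>
    simp only [map_add]
    exact hx.add hy
  | neg x hx =>
    simp only [map_neg]
    exact hx.neg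

end Correlator

section Gauging

variable {N : ℕ} (g a : ℝ) (p : ℕ) (d : LoopDir) {R S κ : MatRep (SU N)}

lemma integral_char_hol_mul_char_hol_of_iso (hS : S.IsIrreducible) (h : R.conj.Iso S) :
    ∫ U, R.char (d.hol U) * S.char (d.hol U) ∂SU.haar N = 1 := by
  have hchar (U : SU N) : R.char U = S.char U⁻¹ := by
    rw [R.char_eq_char_conj_inv, MatRep.char_iso h]
  rw [← MatRep.integral_char_mul_char_inv (SU.haar N) hS]
  cases d <;> simp only [LoopDir.hol, hchar, inv_inv, mul_comm]

lemma integral_char_hol_mul_char_hol_of_not_iso (hR : R.IsIrreducible) (hS : S.IsIrreducible)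
    (h : ¬ R.conj.Iso S) : ∫ U, R.char (d.hol U) * S.char (d.hol U) ∂SU.haar N = 0 := by
  cases d
  · rw [← MatRep.integral_char_mul_char_inv_of_not_iso (SU.haar N) hS hR.conj h]
    simp only [LoopDir.hol, R.char_eq_char_conj_inv, mul_comm]
  · rw [← MatRep.integral_char_mul_char_inv_of_not_iso (SU.haar N) hR.conj hS
      fun hSR => h ((MatRep.setoid _).symm hSR)]
    simp only [LoopDir.hol, R.char_eq_char_conj_inv, inv_inv]

lemma pairing_cls (hR : R.IsIrreducible) (hS : S.IsIrreducible) :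
    pairing g a p d (RepRing.cls R) (RepRing.cls S) =
      weight g a p R * weight g a p S * ∫ U, R.char (d.hol U) * S.char (d.hol U) ∂SU.haar N := by
  simp only [pairing, corr_cls g a p d hR, corr_cls g a p d hS]
  rw [← integral_const_mul]
  refine congrArg _ (funext fun U => ?_)
  ring

lemma pairing_cls_of_iso (hR : R.IsIrreducible) (hS : S.IsIrreducible) (h : R.conj.Iso S) :
    pairing g a p d (RepRing.cls R) (RepRing.cls S) = (weight g a p S : ℂ) ^ 2 := by
  rw [pairing_cls g a p d hR hS, integral_char_hol_mul_char_hol_of_iso d hS h, mul_one,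
    ← weight_conj, weight_iso g a p h, sq]

lemma pairing_cls_of_not_iso (hR : R.IsIrreducible) (hS : S.IsIrreducible)
    (h : ¬ R.conj.Iso S) : pairing g a p d (RepRing.cls R) (RepRing.cls S) = 0 := by
  rw [pairing_cls g a p d hR hS, integral_char_hol_mul_char_hol_of_not_iso d hR hS h, mul_zero]

lemma integrable_char_mul_corr (κ : MatRep (SU N)) (x : RepRing (SU N)) :
    Integrable (fun U => κ.char U * corr g a p d (ConjClasses.mk U) x) (SU.haar N) :=
  integrable_of_continuous (κ.continuous_char.mul (continuous_corr g a p d x)) _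

lemma weight_ne_zero (hκ : κ.IsIrreducible) : (weight g a p κ : ℂ) ≠ 0 :=
  Complex.ofReal_ne_zero.mpr (weight_pos g a p hκ).ne'

lemma gauged_eq_pairing (hκ : κ.IsIrreducible) (x : RepRing (SU N)) :
    gauged g a p d κ x = (weight g a p κ : ℂ)⁻¹ *
      pairing g a p d (RepRing.cls (d.selected κ).conj) x := by
  have hcorr (U : SU N) : κ.char U = (weight g a p κ : ℂ)⁻¹ *
      corr g a p d (ConjClasses.mk U) (RepRing.cls (d.selected κ).conj) := by
    rw [corr_cls g a p d (d.isIrreducible_selected hκ).conj, weight_conj, d.weight_selected,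
      ← d.char_eq_char_selected_conj_hol, mul_comm, mul_inv_cancel_right₀ (weight_ne_zero g a p hκ)]
  simp only [gauged, pairing, hcorr, mul_assoc, integral_const_mul]

lemma gauged_cls_of_iso (hκ : κ.IsIrreducible) (hR : R.IsIrreducible)
    (h : (d.selected κ).Iso R) : gauged g a p d κ (RepRing.cls R) = weight g a p R := by
  rw [gauged_eq_pairing g a p d hκ, pairing_cls_of_iso g a p d (d.isIrreducible_selected hκ).conj hR
    (by rwa [MatRep.conj_conj]), ← d.weight_selected, weight_iso g a p h, sq,
    inv_mul_cancel_left₀ (weight_ne_zero g a p hR)]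

lemma gauged_cls_of_not_iso (hκ : κ.IsIrreducible) (hR : R.IsIrreducible)
    (h : ¬ (d.selected κ).Iso R) : gauged g a p d κ (RepRing.cls R) = 0 := by
  rw [gauged_eq_pairing g a p d hκ, pairing_cls_of_not_iso g a p d
    (d.isIrreducible_selected hκ).conj hR (by rwa [MatRep.conj_conj]), mul_zero]

/-- Gauging `YM.gauged` with theta-angle `κ` as an additive functional on the Grothendieck ring. -/
def gaugedHom (κ : MatRep (SU N)) : RepRing (SU N) →+ ℂ :=
  AddMonoidHom.mk' (gauged g a p d κ) fun x y => by
    simp only [gauged, map_add, mul_add]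
    exact integral_add (integrable_char_mul_corr g a p d κ x) (integrable_char_mul_corr g a p d κ y)

end Gauging

theorem RepRing.exists_projector {G : Type} [Group G] [TopologicalSpace G]
    [IsTopologicalGroup G] [CompactSpace G] {S : MatRep G} (hS : S.IsIrreducible)
    {f : RepRing G →+ ℂ} (hiso : ∀ R : MatRep G, R.IsIrreducible → S.Iso R → f (cls R) = 1)
    (hnot : ∀ R : MatRep G, R.IsIrreducible → ¬ S.Iso R → f (cls R) = 0) :
    ∃ P : RepRing G →+ RepRing G, (∀ x, ∃ n : ℤ, P x = n • cls S ∧ f x = n) ∧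
      (∀ x, P (P x) = P x) ∧
      ∀ Q : RepRing G →+ RepRing G, Q = P ↔ ∀ R : MatRep G, R.IsIrreducible →
        (S.Iso R → Q (cls R) = cls R) ∧ (¬ S.Iso R → Q (cls R) = 0) := by
  obtain ⟨n, hn⟩ : ∃ n : RepRing G →+ ℤ, ∀ x, f x = n x := by
    refine exists_intCast_eq fun R hR => ?_
    by_cases h : S.Iso R
    · exact ⟨1, by rw [hiso R hR h, Int.cast_one]⟩
    · exact ⟨0, by rw [hnot R hR h, Int.cast_zero]⟩
  have hone (R : MatRep G) (hR : R.IsIrreducible) (h : S.Iso R) : n (cls R) = 1 := by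
    exact_mod_cast (hn _).symm.trans (hiso R hR h)
  have hzero (R : MatRep G) (hR : R.IsIrreducible) (h : ¬ S.Iso R) : n (cls R) = 0 := by
    exact_mod_cast (hn _).symm.trans (hnot R hR h)
  let P : RepRing G →+ RepRing G := (zmultiplesHom _ (cls S)).comp n
  have hP (x : RepRing G) : P x = n x • cls S := rfl
  have hPiso (R : MatRep G) (hR : R.IsIrreducible) (h : S.Iso R) : P (cls R) = cls R := by
    rw [hP, hone R hR h, one_zsmul, cls_iso h]
  have hPnot (R : MatRep G) (hR : R.IsIrreducible) (h : ¬ S.Iso R) : P (cls R) = 0 := by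
    rw [hP, hzero R hR h, zero_zsmul]
  refine ⟨P, fun x => ⟨n x, hP x, hn x⟩, fun x => ?_, fun Q => ⟨?_, fun hQ => ?_⟩⟩
  · rw [hP x, map_zsmul, hPiso S hS ((MatRep.setoid G).refl S)]
  · rintro rfl R hR
    exact ⟨hPiso R hR, hPnot R hR⟩
  · refine addMonoidHom_ext fun R hR => ?_
    by_cases h : S.Iso R
    · exact ((hQ R hR).1 h).trans (hPiso R hR h).symm
    · exact ((hQ R hR).2 h).trans (hPnot R hR h).symm

theorem existsUnique_gauging_projector {N : ℕ} (g a : ℝ) (p : ℕ) (d : LoopDir) {κ : MatRep (SU N)}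
    (hκ : κ.IsIrreducible) :
    ∃! P : RepRing (SU N) →+ RepRing (SU N),
      (∀ R : MatRep (SU N), R.IsIrreducible →
        ((d.selected κ).Iso R → P (RepRing.cls R) = RepRing.cls R) ∧
        (¬ (d.selected κ).Iso R → P (RepRing.cls R) = 0)) ∧
      (∀ x, P (P x) = P x) ∧
      ∀ x, ∃ n : ℤ, P x = n • RepRing.cls (d.selected κ) ∧
        gauged g a p d κ x = n * weight g a p κ := by
  have hw := weight_ne_zero g a p hκ
  let f : RepRing (SU N) →+ ℂ :=
    (AddMonoidHom.mulRight (weight g a p κ : ℂ)⁻¹).comp (gaugedHom g a p d κ)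
  have hf (x : RepRing (SU N)) : f x = gauged g a p d κ x * (weight g a p κ : ℂ)⁻¹ := rfl
  obtain ⟨P, hP, hPP, hunique⟩ := RepRing.exists_projector (d.isIrreducible_selected hκ) (f := f)
    (fun R hR h => by
      rw [hf, gauged_cls_of_iso g a p d hκ hR h, ← weight_iso g a p h, d.weight_selected,
        mul_inv_cancel₀ hw])
    (fun R hR h => by rw [hf, gauged_cls_of_not_iso g a p d hκ hR h, zero_mul])
  refine ⟨P, ⟨(hunique P).mp rfl, hPP, fun x => ?_⟩, fun Q hQ => (hunique Q).mpr hQ.1⟩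
  obtain ⟨n, hPx, hfx⟩ := hP x
  exact ⟨n, hPx, (mul_inv_eq_iff_eq_mul₀ hw).mp hfx⟩

end YM

end

theorem proposition4p2 (N : ℕ) (g a : ℝ) (p : ℕ) (κ : MatRep (SU N)) (hκ : κ.IsIrreducible) :
    -- the Casimir operator acts on an irreducible representation by the scalar `C₂`
    (∀ R : MatRep (SU N), R.IsIrreducible → R.casimir = (R.C2 : ℂ) • 1) ∧
    -- the topological point operators act on Wilson loops through the character
    (∀ R : MatRep (SU N), R.IsIrreducible → ∀ U : SU N,
      corr g a p .opposite (ConjClasses.mk U) (RepRing.cls R) = R.char U * weight g a p R ∧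
      corr g a p .along (ConjClasses.mk U) (RepRing.cls R) = R.char U⁻¹ * weight g a p R) ∧
    -- the integral that defines the gauging converges
    (∀ (d : LoopDir) (x : RepRing (SU N)),
      Integrable (fun U => κ.char U * corr g a p d (ConjClasses.mk U) x) (SU.haar N)) ∧
    -- the pairing of irreducible representations
    (∀ (d : LoopDir) (R₁ R₂ : MatRep (SU N)), R₁.IsIrreducible → R₂.IsIrreducible →
      (R₁.conj.Iso R₂ →
        pairing g a p d (RepRing.cls R₁) (RepRing.cls R₂) = (weight g a p R₂ : ℂ) ^ 2) ∧
      (¬ R₁.conj.Iso R₂ → pairing g a p d (RepRing.cls R₁) (RepRing.cls R₂) = 0)) ∧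
    -- gauging selects a single irreducible representation
    (∀ (d : LoopDir) (R : MatRep (SU N)), R.IsIrreducible →
      ((d.selected κ).Iso R → gauged g a p d κ (RepRing.cls R) = weight g a p R) ∧
      (¬ (d.selected κ).Iso R → gauged g a p d κ (RepRing.cls R) = 0)) ∧
    -- gauging is the functional `⟨κ|` (or `⟨κ̄|`) on the Grothendieck ring
    (∀ x : RepRing (SU N),
      gauged g a p .opposite κ x =
        (weight g a p κ : ℂ)⁻¹ * pairing g a p .opposite (RepRing.cls κ) x ∧
      gauged g a p .along κ x =
        (weight g a p κ : ℂ)⁻¹ * pairing g a p .along (RepRing.cls κ.conj) x) ∧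
    -- it amounts to the projector of the Grothendieck ring onto the selected representation
    (∀ d : LoopDir, ∃! P : RepRing (SU N) →+ RepRing (SU N),
      (∀ R : MatRep (SU N), R.IsIrreducible →
        ((d.selected κ).Iso R → P (RepRing.cls R) = RepRing.cls R) ∧
        (¬ (d.selected κ).Iso R → P (RepRing.cls R) = 0)) ∧
      (∀ x, P (P x) = P x) ∧
      ∀ x, ∃ n : ℤ, P x = n • RepRing.cls (d.selected κ) ∧
        gauged g a p d κ x = n * weight g a p κ) :=
  ⟨fun _ hR => MatRep.casimir_eq_smul_one hR,
    fun _ hR U => ⟨corr_cls g a p .opposite hR U, corr_cls g a p .along hR U⟩,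
    fun d x => integrable_char_mul_corr g a p d κ x,
    fun d _ _ h₁ h₂ => ⟨pairing_cls_of_iso g a p d h₁ h₂, pairing_cls_of_not_iso g a p d h₁ h₂⟩,
    fun d _ hR => ⟨gauged_cls_of_iso g a p d hκ hR, gauged_cls_of_not_iso g a p d hκ hR⟩,
    fun x => ⟨(gauged_eq_pairing g a p .opposite hκ x).trans
        (by rw [LoopDir.selected, MatRep.conj_conj]),
      gauged_eq_pairing g a p .along hκ x⟩,
    fun d => existsUnique_gauging_projector g a p d hκ⟩
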